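/- **Proposition ("boundary values").** Let $\mathbb D=\{t\in\mathbb C:|t|<1\}$, let $\sigma$ be the rotation invariant probability measure on $\partial\mathbb D$, and for an integrable function $h$ on $\partial\mathbb D$ write $P[h](t)=\int_{\partial\mathbb D}\frac{1-|t|^2}{|s-t|^2}h(s)\,d\sigma(s)$ ($t\in\mathbb D$) for its Poisson integral. For $1\le r\le\infty$ let $H^r(\mathbb D,\mathbb C^n)$ be the space of holomorphic functions on $\mathbb D$ of the form $P[f]$ with $f\in L^r(\partial\mathbb D,\mathbb C^n)$; such a function is identified with its boundary function $f$. Write $z\cdot w=\sum_j z_jw_j$ for $z,w\in\mathbb C^n$, and $|\cdot|$ for the Euclidean norm. Let $p\in(1,\infty)$, $q=p/(p-1)$, and let $\phi:\partial\mathbb D\times\mathbb C^n\to\mathbb R$ be a Borel measurable function such that $\phi_s=\phi(s,\cdot)$ is convex on $\mathbb C^n=\mathbb R^{2n}$ for every $s\in\partial\mathbb D$ and such that, for some constants $c,C,A>0$, $$c|w|^p-A\le\phi_s(w)\le C|w|^p+A\qquad(s\in\partial\mathbb D,\ w\in\mathbb C^n).$$ For $\psi:\mathbb D\times\mathbb C^n\to\mathbb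 R$ write $\psi\preceq\phi$ if for almost every $s\in\partial\mathbb D$ and all $z\in\mathbb C^n$ one has $\limsup_{(r,w)\to(1,z),\,0<r<1}\psi(rs,w)\le\phi(s,z)$. For $(t,w)\in\mathbb D\times\mathbb C^n$ define * $\tilde\phi(t,w)=\sup L_{f_0,f}(t,w)$, where $L_{f_0,f}(t,w)=\operatorname{Re}(f(t)\cdot w)-P[\operatorname{Re}f_0](t)$, over all $f_0\in L^1(\partial\mathbb D,\mathbb C)$ and $f\in H^q(\mathbb D,\mathbb C^n)$ with $L_{f_0,f}\preceq\phi$; * $\hat\phi(t,w)=\sup\psi(t,w)$ over all plurisubharmonic $\psi:\mathbb D\times\mathbb C^n\to\mathbb R$ with $\psi(t',w')\le\sup_{s\in\partial\mathbb D}\phi(s,w')$ on $\mathbb D\times\mathbb C^n$ and $\psi\preceq\phi$; * $\check\phi(t,w)=\inf P[\phi(s,f(s))](t)$ over all $f\in H^p(\mathbb D,\mathbb C^n)$ with $f(t)=w$. Let $[\phi]$ be any one of the three functions $\tilde\phi,\hat\phi,\check\phi$, and put $[\phi]_t=[\phi](t,\cdot)$. Then $[\phi]$ is finite on $\mathbb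 D\times\mathbb C^n$, and for almost every $s\in\partial\mathbb D$, $$[\phi]_{rs}\longrightarrow\phi_s\quad\text{as } r\to1^-,\qquad\text{locally uniformly in }\mathbb C^n.$$ -/

import Mathlib

open MeasureTheory Filter Topology Metric Set

noncomputable section

/-- The Hermitian space `ℂⁿ`, with norm `|·|`. -/
abbrev Cn (n : ℕ) : Type := EuclideanSpace ℂ (Fin n)

/-- The boundary `∂𝔻` of the unit disk, with its Borel structure. -/
abbrev DiskBoundary : Type := Metric.sphere (0 : ℂ) 1

/-- The point `e^{iθ}` of `∂𝔻`. -/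
def expPoint (θ : ℝ) : DiskBoundary :=
  ⟨Complex.exp (θ * Complex.I), by simp [Complex.norm_exp_ofReal_mul_I]⟩

/-- The rotation invariant probability measure `σ = dθ / 2π` on `∂𝔻`. -/
def boundaryMeasure : Measure DiskBoundary :=
  ENNReal.ofReal (2 * Real.pi)⁻¹ •
    Measure.map expPoint (volume.restrict (Ioc 0 (2 * Real.pi)))

/-- The bilinear pairing `z · w = ∑ⱼ zⱼ wⱼ` (no conjugation). -/
def cdot {n : ℕ} (z w : Cn n) : ℂ := ∑ j, z j * w j

/-- The Poisson integral `P[h](t) = ∫ (1 - |t|²) / |s - t|² h(s) dσ(s)`, for `t` in the unit disk. -/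
def poissonInt {V : Type*} [NormedAddCommGroup V] [NormedSpace ℝ V]
    (h : DiskBoundary → V) (t : ℂ) : V :=
  ∫ s : DiskBoundary, poissonKernel 0 t (s : ℂ) • h s ∂boundaryMeasure

/-- `f` is the boundary function of an element of the Hardy space `Hʳ(𝔻, ℂⁿ)`: `f` lies in
`Lʳ(∂𝔻, ℂⁿ)` and its Poisson extension, which is the element of `Hʳ`, is holomorphic on `𝔻`. -/
def IsHardyBoundary {n : ℕ} (r : ℝ) (f : DiskBoundary → Cn n) : Prop :=
  MemLp f (ENNReal.ofReal r) boundaryMeasure ∧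
    DifferentiableOn ℂ (poissonInt f) (ball (0 : ℂ) 1)

/-- The `p`-uniform growth condition, for finite `p`. -/
def UniformGrowth {n : ℕ} (p : ℝ) (φ : DiskBoundary → Cn n → ℝ) : Prop :=
  ∃ c C A : ℝ, 0 < c ∧ 0 < C ∧ 0 < A ∧
    ∀ (s : DiskBoundary) (w : Cn n), c * ‖w‖ ^ p - A ≤ φ s w ∧ φ s w ≤ C * ‖w‖ ^ p + A

/-- The relation `ψ ⪯ φ` on `∂𝔻 × ℂⁿ`: for almost every `s` and every `z`, the upper limit of
`ψ(rs, w)` as `r → 1⁻`, `w → z` is at most `φ(s, z)`. -/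
def BoundaryLE {n : ℕ} (ψ : ℂ → Cn n → ℝ) (φ : DiskBoundary → Cn n → ℝ) : Prop :=
  ∀ᵐ s : DiskBoundary ∂boundaryMeasure, ∀ z : Cn n,
    limsup (fun x : ℝ × Cn n => ((ψ ((x.1 : ℂ) * (s : ℂ)) x.2 : ℝ) : EReal))
      (𝓝[<] (1 : ℝ) ×ˢ 𝓝 z) ≤ ((φ s z : ℝ) : EReal)

/-- Real-valued plurisubharmonic functions on `𝔻 × ℂⁿ`: upper semicontinuous, with the sub-mean
value inequality on every closed complex disc `{(t + ζτ, w + ζv) : |ζ| ≤ 1}` in `𝔻 × ℂⁿ`.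
The integral over the circle of an upper semicontinuous function always exists in `[-∞, ∞)`, and
the inequality forces it to be finite, which is what the integrability clause says. -/
def IsPSH {n : ℕ} (ψ : ℂ → Cn n → ℝ) : Prop :=
  UpperSemicontinuousOn (fun x : ℂ × Cn n => ψ x.1 x.2) (ball (0 : ℂ) 1 ×ˢ univ) ∧
    ∀ (t τ : ℂ) (w v : Cn n), (∀ ζ : ℂ, ‖ζ‖ ≤ 1 → ‖t + ζ * τ‖ < 1) →
      CircleIntegrable (fun ζ : ℂ => ψ (t + ζ * τ) (w + ζ • v)) 0 1 ∧
        ψ t w ≤ Real.circleAverage (fun ζ : ℂ => ψ (t + ζ * τ) (w + ζ • v)) 0 1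

/-- The function `L_{f₀,f}(t, w) = Re (f(t) · w) - P[Re f₀](t)`. -/
def linFun {n : ℕ} (f₀ : DiskBoundary → ℂ) (f : DiskBoundary → Cn n) (t : ℂ) (w : Cn n) : ℝ :=
  (cdot (poissonInt f t) w).re - poissonInt (fun s => (f₀ s).re) t

/-- The hull `φ̃`: the supremum of the functions `L_{f₀,f} ⪯ φ` with `f₀ ∈ L¹`, `f ∈ H^q` and
`q = p / (p - 1)`. -/
def linearHull {n : ℕ} (p : ℝ) (φ : DiskBoundary → Cn n → ℝ) (t : ℂ) (w : Cn n) : EReal :=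
  sSup {x : EReal | ∃ (f₀ : DiskBoundary → ℂ) (f : DiskBoundary → Cn n),
    Integrable f₀ boundaryMeasure ∧ IsHardyBoundary (p / (p - 1)) f ∧
      BoundaryLE (linFun f₀ f) φ ∧ x = ((linFun f₀ f t w : ℝ) : EReal)}

/-- The hull `φ̂` (Perron–Bremermann envelope): the supremum of the plurisubharmonic `ψ` with
`ψ(t, w) ≤ μ(w) = sup_s φ(s, w)` on `𝔻 × ℂⁿ` and `ψ ⪯ φ` on `∂𝔻 × ℂⁿ`. -/
def pshHull {n : ℕ} (φ : DiskBoundary → Cn n → ℝ) (t : ℂ) (w : Cn n) : EReal :=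
  sSup {x : EReal | ∃ ψ : ℂ → Cn n → ℝ, IsPSH ψ ∧
    (∀ t' ∈ ball (0 : ℂ) 1, ∀ w' : Cn n,
      ((ψ t' w' : ℝ) : EReal) ≤ ⨆ s : DiskBoundary, ((φ s w' : ℝ) : EReal)) ∧
    BoundaryLE ψ φ ∧ x = ((ψ t w : ℝ) : EReal)}

/-- The hull `φ̌`: the infimum of `P[φ(s, f(s))](t)` over the `f ∈ H^p` with `f(t) = w`. -/
def discHull {n : ℕ} (p : ℝ) (φ : DiskBoundary → Cn n → ℝ) (t : ℂ) (w : Cn n) : EReal :=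
  sInf {x : EReal | ∃ f : DiskBoundary → Cn n, IsHardyBoundary p f ∧ poissonInt f t = w ∧
    x = ((poissonInt (fun s => φ s (f s)) t : ℝ) : EReal)}

end

noncomputable section

/-! ### The measure on the circle -/

/-! Each hull lies between two explicit envelopes. From above it is bounded by `P[φ(·,w)](t)`; from
below, for every slope `a`, by `Re (a · w) - P[φ*(a)](t)`, with `φ*` the fibrewise convex conjugate.

Half of these bounds come from constant competitors. The affine functions of constant slope `a`
compete in `φ̃` and `φ̂` by Fenchel–Young and Fatou; the constant disc `w` competes in `φ̌`. For the
other half, `φ̌` is bounded below by integrating Fenchel–Young along a disc (`le_poissonInt_comp`),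
`φ̃` above by identifying radial limits (`linFun_le_poissonInt`), and `φ̂` above by a Poisson
majorant theorem for subharmonic functions bounded above (`le_poissonInt_of_radial`).

Fatou's theorem (`ae_tendsto_poissonInt`) sends the envelopes to `φ_s(w)` and `Re (a · w) - φ*_s(a)`
at almost every `s`. Countable dense sets of `w` and `a` share one null set, Fenchel–Moreau duality
makes the limits meet, and Lipschitz bounds uniform in `s` turn pointwise control into locally
uniform convergence (`exists_tendstoLocallyUniformly`). -/

lemma continuous_expPoint : Continuous expPoint := by
  unfold expPoint
  fun_prop

lemma coe_expPoint (θ : ℝ) : (expPoint θ : ℂ) = circleMap 0 1 θ := by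
  simp [expPoint, circleMap]

lemma expPoint_add_two_pi (θ : ℝ) : expPoint (θ + 2 * Real.pi) = expPoint θ := by
  apply Subtype.ext
  rw [coe_expPoint, coe_expPoint, periodic_circleMap]

lemma exists_expPoint_eq (s : DiskBoundary) : ∃ θ : ℝ, expPoint θ = s := by
  refine ⟨Complex.arg s, Subtype.ext ?_⟩
  have := Complex.norm_mul_exp_arg_mul_I (s : ℂ)
  simpa [expPoint] using this

/-- An injective parametrisation, rather than a merely measurable one, transfers integrals and
almost-everywhere statements with no measurability assumption on the integrand or predicate. -/
lemma measurableEmbedding_expPoint :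
    MeasurableEmbedding ((Ioc 0 (2 * Real.pi)).domRestrict expPoint) := by
  refine ContinuousOn.measurableEmbedding measurableSet_Ioc continuous_expPoint.continuousOn ?_
  have h := injOn_circleMap_of_abs_sub_le (a := 0) (b := 2 * Real.pi) (c := 0) one_ne_zero
    (by simp [abs_of_pos Real.pi_pos])
  rw [uIoc_of_le Real.two_pi_pos.le] at h
  intro x hx y hy hxy
  apply h hx hy
  rw [← coe_expPoint, ← coe_expPoint, hxy]

lemma boundaryMeasure_eq : boundaryMeasure = ENNReal.ofReal (2 * Real.pi)⁻¹ •
    Measure.map ((Ioc 0 (2 * Real.pi)).domRestrict expPoint)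
      (Measure.comap Subtype.val (volume : Measure ℝ)) := by
  rw [boundaryMeasure, ← map_comap_subtype_coe measurableSet_Ioc,
    Measure.map_map continuous_expPoint.measurable measurable_subtype_coe]
  rfl

lemma ae_boundaryMeasure_iff {Q : DiskBoundary → Prop} :
    (∀ᵐ s ∂boundaryMeasure, Q s) ↔
      ∀ᵐ θ ∂volume.restrict (Ioc 0 (2 * Real.pi)), Q (expPoint θ) := by
  have hc : ENNReal.ofReal (2 * Real.pi)⁻¹ ≠ 0 := by
    simp [Real.pi_pos]
  rw [boundaryMeasure_eq, Measure.ae_ennreal_smul_measure_iff hc,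
    measurableEmbedding_expPoint.ae_map_iff, ← map_comap_subtype_coe measurableSet_Ioc,
    (MeasurableEmbedding.subtype_coe measurableSet_Ioc).ae_map_iff]
  rfl

lemma integral_boundaryMeasure {V : Type*} [NormedAddCommGroup V] [NormedSpace ℝ V]
    (g : DiskBoundary → V) :
    ∫ s, g s ∂boundaryMeasure =
      (2 * Real.pi)⁻¹ • ∫ θ in (0)..(2 * Real.pi), g (expPoint θ) := by
  rw [boundaryMeasure_eq, integral_smul_measure, measurableEmbedding_expPoint.integral_map,
    intervalIntegral.integral_of_le Real.two_pi_pos.le, ENNReal.toReal_ofReal (by positivity),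
    ← integral_subtype_comap measurableSet_Ioc]
  rfl

lemma integrable_boundaryMeasure_iff {V : Type*} [NormedAddCommGroup V]
    {g : DiskBoundary → V} : Integrable g boundaryMeasure ↔
      IntervalIntegrable (fun θ => g (expPoint θ)) volume 0 (2 * Real.pi) := by
  have hc : ENNReal.ofReal (2 * Real.pi)⁻¹ ≠ 0 := by
    simp [Real.pi_pos]
  rw [boundaryMeasure_eq, integrable_smul_measure hc ENNReal.ofReal_ne_top,
    measurableEmbedding_expPoint.integrable_map_iff,
    intervalIntegrable_iff_integrableOn_Ioc_of_le Real.two_pi_pos.le, IntegrableOn,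
    ← map_comap_subtype_coe measurableSet_Ioc,
    (MeasurableEmbedding.subtype_coe measurableSet_Ioc).integrable_map_iff]
  rfl

instance isProbabilityMeasure_boundaryMeasure : IsProbabilityMeasure boundaryMeasure := by
  constructor
  rw [boundaryMeasure, Measure.smul_apply, Measure.map_apply continuous_expPoint.measurable
    MeasurableSet.univ]
  simp only [preimage_univ, Measure.restrict_apply_univ, Real.volume_Ioc, sub_zero, smul_eq_mul]
  rw [← ENNReal.ofReal_mul (by positivity), inv_mul_cancel₀ (by positivity), ENNReal.ofReal_one]

lemma norm_coe_diskBoundary (s : DiskBoundary) : ‖(s : ℂ)‖ = 1 := by simp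

/-! ### The Poisson kernel and Poisson integrals -/

lemma poissonKernel_zero_eq (t : ℂ) (s : DiskBoundary) :
    poissonKernel 0 t s = (1 - ‖t‖ ^ 2) / ‖(s : ℂ) - t‖ ^ 2 := by
  simp [poissonKernel_def]

lemma coe_sub_ne_zero {t : ℂ} (ht : t ∈ ball (0 : ℂ) 1) (s : DiskBoundary) :
    (s : ℂ) - t ≠ 0 := by
  intro h
  rw [mem_ball_zero_iff, ← sub_eq_zero.1 h, norm_coe_diskBoundary] at ht
  exact lt_irrefl _ ht

lemma poissonKernel_nonneg {t : ℂ} (ht : t ∈ ball (0 : ℂ) 1) (s : DiskBoundary) :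
    0 ≤ poissonKernel 0 t s := by
  rw [mem_ball_zero_iff] at ht
  rw [poissonKernel_zero_eq]
  have : ‖t‖ ^ 2 ≤ 1 := by nlinarith [norm_nonneg t]
  exact div_nonneg (by linarith) (by positivity)

lemma poissonKernel_le_two_div {t : ℂ} (ht : t ∈ ball (0 : ℂ) 1) (s : DiskBoundary) :
    poissonKernel 0 t s ≤ 2 / (1 - ‖t‖) := by
  have ht' := mem_ball_zero_iff.1 ht
  have h := re_herglotzRieszKernel_le (c := 0) (R := 1) (z := (s : ℂ)) (w := t) (by simp) ht
  rw [poissonKernel_eq_re_herglotzRieszKernel, Function.comp_apply, herglotzRieszKernel_def]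
  refine h.trans ?_
  simp only [sub_zero]
  have : 0 < 1 - ‖t‖ := by linarith
  gcongr
  linarith

lemma continuous_poissonKernel {t : ℂ} (ht : t ∈ ball (0 : ℂ) 1) :
    Continuous (fun s : DiskBoundary => poissonKernel 0 t s) := by
  simp only [poissonKernel_zero_eq]
  exact continuous_const.div (by fun_prop) fun s =>
    pow_ne_zero _ (norm_ne_zero_iff.2 (coe_sub_ne_zero ht s))

section

variable {V : Type*} [NormedAddCommGroup V] [NormedSpace ℝ V]

lemma integrable_poissonKernel_smul {t : ℂ} (ht : t ∈ ball (0 : ℂ) 1) {h : DiskBoundary → V}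
    (hh : Integrable h boundaryMeasure) :
    Integrable (fun s : DiskBoundary => poissonKernel 0 t s • h s) boundaryMeasure := by
  refine hh.bdd_smul (2 / (1 - ‖t‖)) (continuous_poissonKernel ht).aestronglyMeasurable
    (ae_of_all _ fun s => ?_)
  rw [Real.norm_of_nonneg (poissonKernel_nonneg ht s)]
  exact poissonKernel_le_two_div ht s

lemma integral_boundaryMeasure_eq_circleAverage (F : ℂ → V) :
    ∫ s : DiskBoundary, F s ∂boundaryMeasure = Real.circleAverage F 0 1 := by
  rw [integral_boundaryMeasure, Real.circleAverage_def]
  simp only [coe_expPoint]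

lemma integral_poissonKernel {t : ℂ} (ht : t ∈ ball (0 : ℂ) 1) :
    ∫ s : DiskBoundary, poissonKernel 0 t s ∂boundaryMeasure = 1 := by
  rw [integral_boundaryMeasure_eq_circleAverage]
  have h := InnerProductSpace.HarmonicOnNhd.circleAverage_poissonKernel_smul
    (f := fun _ : ℂ => (1 : ℝ)) (fun x _ => InnerProductSpace.harmonicAt_const _) ht
  simpa [Pi.smul_def, Pi.mul_def] using h

lemma poissonInt_const [CompleteSpace V] {t : ℂ} (ht : t ∈ ball (0 : ℂ) 1) (v : V) :
    poissonInt (fun _ => v) t = v := by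
  rw [poissonInt, integral_smul_const, integral_poissonKernel ht, one_smul]

lemma poissonInt_add {t : ℂ} (ht : t ∈ ball (0 : ℂ) 1) {g h : DiskBoundary → V}
    (hg : Integrable g boundaryMeasure) (hh : Integrable h boundaryMeasure) :
    poissonInt (fun s => g s + h s) t = poissonInt g t + poissonInt h t := by
  simp only [poissonInt, smul_add]
  exact integral_add (integrable_poissonKernel_smul ht hg) (integrable_poissonKernel_smul ht hh)

lemma poissonInt_sub {t : ℂ} (ht : t ∈ ball (0 : ℂ) 1) {g h : DiskBoundary → V}
    (hg : Integrable g boundaryMeasure) (hh : Integrable h boundaryMeasure) :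
    poissonInt (fun s => g s - h s) t = poissonInt g t - poissonInt h t := by
  simp only [poissonInt, smul_sub]
  exact integral_sub (integrable_poissonKernel_smul ht hg) (integrable_poissonKernel_smul ht hh)

lemma poissonInt_clm {W : Type*} [NormedAddCommGroup W] [NormedSpace ℝ W] [CompleteSpace V]
    [CompleteSpace W] (L : V →L[ℝ] W) {t : ℂ} (ht : t ∈ ball (0 : ℂ) 1) {h : DiskBoundary → V}
    (hh : Integrable h boundaryMeasure) :
    poissonInt (fun s => L (h s)) t = L (poissonInt h t) := by
  simp only [poissonInt, ← L.map_smul]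
  exact L.integral_comp_comm (integrable_poissonKernel_smul ht hh)

end

lemma poissonInt_mono {t : ℂ} (ht : t ∈ ball (0 : ℂ) 1) {g h : DiskBoundary → ℝ}
    (hg : Integrable g boundaryMeasure) (hh : Integrable h boundaryMeasure)
    (hgh : ∀ᵐ s ∂boundaryMeasure, g s ≤ h s) :
    poissonInt g t ≤ poissonInt h t := by
  refine integral_mono_ae (integrable_poissonKernel_smul ht hg)
    (integrable_poissonKernel_smul ht hh) ?_
  filter_upwards [hgh] with s hs
  exact mul_le_mul_of_nonneg_left hs (poissonKernel_nonneg ht s)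

/-- A Poisson integral is the real part of a holomorphic function. -/
lemma exists_differentiableOn_re_eq_poissonInt {h : DiskBoundary → ℝ}
    (hh : Integrable h boundaryMeasure) :
    ∃ F : ℂ → ℂ, DifferentiableOn ℂ F (ball 0 1) ∧
      ∀ t ∈ ball (0 : ℂ) 1, poissonInt h t = (F t).re := by
  set g : ℂ → ℝ := Function.extend Subtype.val h 0 with hg
  have hgs (s : DiskBoundary) : g s = h s := Subtype.val_injective.extend_apply h 0 s
  have hgi : CircleIntegrable g 0 1 := by
    have := integrable_boundaryMeasure_iff.1 hh
    simp only [← hgs, coe_expPoint] at this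
    exact this
  have hgc : CircleIntegrable (fun ζ => (g ζ : ℂ)) 0 1 := by
    have := integrable_boundaryMeasure_iff.1 (hh.ofReal (𝕜 := ℂ))
    simp only [← hgs, coe_expPoint] at this
    exact this
  refine ⟨_, differentiableOn_circleAverage_herglotzRieszKernel_smul hgc, fun t ht => ?_⟩
  rw [re_circleAverage_herglotzRieszKernel_smul hgi ht, ← poissonKernel_eq_re_herglotzRieszKernel,
    ← integral_boundaryMeasure_eq_circleAverage, poissonInt]
  simp [hgs]

/-- The Poisson integral formula for real parts of entire functions. -/
lemma poissonInt_re_eq {G : ℂ → ℂ} (hG : Differentiable ℂ G) {t : ℂ} (ht : t ∈ ball (0 : ℂ) 1) :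
    poissonInt (fun s : DiskBoundary => (G s).re) t = (G t).re := by
  have h := hG.diffContOnCl.circleAverage_poissonKernel_smul (c := 0) (R := 1) ht
  rw [← integral_boundaryMeasure_eq_circleAverage] at h
  have hc : Continuous fun s : DiskBoundary => G s := hG.continuous.comp continuous_subtype_val
  have hi : Integrable (fun s : DiskBoundary => G s) boundaryMeasure := by
    rw [integrable_boundaryMeasure_iff]
    exact (hc.comp continuous_expPoint).intervalIntegrable _ _
  have := poissonInt_clm Complex.reCLM ht hi
  simp only [Complex.reCLM_apply] at this
  rw [this, ← h]
  rfl

/-! ### Fatou's theorem on radial limits of Poisson integrals -/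

lemma eventually_pos_nhdsLT_one : ∀ᶠ r in 𝓝[<] (1 : ℝ), 0 < r :=
  (lt_mem_nhds one_pos).filter_mono nhdsWithin_le_nhds

/-- The Poisson kernel as a function of the angle. -/
def angularKernel (r x : ℝ) : ℝ := (1 - r ^ 2) / (1 - 2 * r * Real.cos x + r ^ 2)

lemma angularKernel_denom_pos {r : ℝ} (hr0 : 0 < r) (hr1 : r < 1) (x : ℝ) :
    0 < 1 - 2 * r * Real.cos x + r ^ 2 := by
  nlinarith [Real.cos_le_one x, sq_pos_of_pos (sub_pos.2 hr1)]

lemma poissonKernel_expPoint (r θ₀ θ : ℝ) :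
    poissonKernel 0 ((r : ℂ) * expPoint θ₀) (expPoint θ) = angularKernel r (θ - θ₀) := by
  have h : ‖(expPoint θ : ℂ) - r * expPoint θ₀‖ ^ 2 =
      1 - 2 * r * Real.cos (θ - θ₀) + r ^ 2 := by
    rw [coe_expPoint, coe_expPoint, ← Complex.normSq_eq_norm_sq, Complex.normSq_apply]
    simp only [circleMap, Complex.ofReal_one, one_mul, zero_add, Complex.sub_re, Complex.sub_im,
      Complex.exp_ofReal_mul_I_re, Complex.exp_ofReal_mul_I_im, Complex.re_ofReal_mul,
      Complex.im_ofReal_mul, Real.cos_sub]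
    nlinarith [Real.sin_sq_add_cos_sq θ, Real.sin_sq_add_cos_sq θ₀]
  rw [poissonKernel_zero_eq, h, angularKernel]
  simp

lemma hasDerivAt_angularKernel {r : ℝ} (hr0 : 0 < r) (hr1 : r < 1) (x : ℝ) :
    HasDerivAt (angularKernel r)
      (-((1 - r ^ 2) * (2 * r * Real.sin x)) / (1 - 2 * r * Real.cos x + r ^ 2) ^ 2) x := by
  have hD := (angularKernel_denom_pos hr0 hr1 x).ne'
  have h1 : HasDerivAt (fun x => 1 - 2 * r * Real.cos x + r ^ 2) (2 * r * Real.sin x) x := by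
    have := (((Real.hasDerivAt_cos x).const_mul (2 * r)).const_sub 1).add_const (r ^ 2)
    simpa using this
  have := (hasDerivAt_const x (1 - r ^ 2)).div h1 hD
  simp only [zero_mul, zero_sub] at this
  exact this

lemma continuous_deriv_angularKernel {r : ℝ} (hr0 : 0 < r) (hr1 : r < 1) :
    Continuous fun x =>
      -((1 - r ^ 2) * (2 * r * Real.sin x)) / (1 - 2 * r * Real.cos x + r ^ 2) ^ 2 :=
  Continuous.div (by fun_prop) (by fun_prop)
    fun x => pow_ne_zero _ (angularKernel_denom_pos hr0 hr1 x).ne'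

lemma continuous_angularKernel {r : ℝ} (hr0 : 0 < r) (hr1 : r < 1) :
    Continuous (angularKernel r) :=
  continuous_iff_continuousAt.2 fun x => (hasDerivAt_angularKernel hr0 hr1 x).continuousAt

lemma angularKernel_pi {r : ℝ} (hr0 : 0 < r) : angularKernel r Real.pi = (1 - r) / (1 + r) := by
  rw [angularKernel, Real.cos_pi]
  have : (1 + r) ≠ 0 := by positivity
  have h2 : 1 - 2 * r * -1 + r ^ 2 = (1 + r) ^ 2 := by ring
  rw [h2]
  field_simp
  ring

lemma angularKernel_neg (r x : ℝ) : angularKernel r (-x) = angularKernel r x := by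
  simp [angularKernel]

lemma real_mul_mem_ball {r : ℝ} (hr0 : 0 < r) (hr1 : r < 1) (s : DiskBoundary) :
    (r : ℂ) * s ∈ ball (0 : ℂ) 1 := by
  simp [abs_of_pos hr0, hr1]

lemma poissonInt_eq_integral_angularKernel (h : DiskBoundary → ℝ) (r θ₀ : ℝ) :
    poissonInt h ((r : ℂ) * expPoint θ₀) = (2 * Real.pi)⁻¹ *
      ∫ x in (-Real.pi)..Real.pi, angularKernel r x * h (expPoint (x + θ₀)) := by
  rw [poissonInt, integral_boundaryMeasure]
  simp only [poissonKernel_expPoint, smul_eq_mul]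
  congr 1
  set f : ℝ → ℝ := fun x => angularKernel r x * h (expPoint (x + θ₀)) with hf
  have hper : Function.Periodic f (2 * Real.pi) := by
    intro x
    simp only [hf, angularKernel, Real.cos_add_two_pi]
    rw [add_right_comm, expPoint_add_two_pi]
  have h1 : ∫ θ in (0 : ℝ)..(2 * Real.pi), angularKernel r (θ - θ₀) * h (expPoint θ) =
      ∫ θ in (0 : ℝ)..(2 * Real.pi), f (θ - θ₀) := by simp [hf]
  rw [h1, intervalIntegral.integral_comp_sub_right f θ₀]
  have h2 := hper.intervalIntegral_add_eq (0 - θ₀) (-Real.pi)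
  rw [show -Real.pi + 2 * Real.pi = Real.pi by ring] at h2
  rw [← h2]
  congr 1
  ring

lemma integral_angularKernel {r : ℝ} (hr0 : 0 < r) (hr1 : r < 1) :
    ∫ x in (-Real.pi)..Real.pi, angularKernel r x = 2 * Real.pi := by
  have h := poissonInt_eq_integral_angularKernel (fun _ => (1 : ℝ)) r 0
  rw [poissonInt_const (real_mul_mem_ball hr0 hr1 _)] at h
  simp only [mul_one] at h
  have : (2 * Real.pi) ≠ 0 := by positivity
  field_simp at h
  linarith

/-- Integration by parts gives the kernel's mass `2π` minus a nonnegative boundary term. The bound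
is uniform in `r`, so an error `ε |x|` in a primitive costs at most `2π ε`. -/
lemma integral_neg_mul_deriv_angularKernel_le {r : ℝ} (hr0 : 0 < r) (hr1 : r < 1) :
    ∫ x in (-Real.pi)..Real.pi, -(x *
      (-((1 - r ^ 2) * (2 * r * Real.sin x)) / (1 - 2 * r * Real.cos x + r ^ 2) ^ 2)) ≤
      2 * Real.pi := by
  rw [intervalIntegral.integral_neg, intervalIntegral.integral_mul_deriv_eq_deriv_mul
    (u := fun x => x) (u' := fun _ => 1) (fun x _ => hasDerivAt_id x)
    (fun x _ => hasDerivAt_angularKernel hr0 hr1 x) intervalIntegrable_const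
    ((continuous_deriv_angularKernel hr0 hr1).intervalIntegrable _ _)]
  simp only [one_mul]
  rw [integral_angularKernel hr0 hr1, angularKernel_neg, angularKernel_pi hr0]
  have : 0 ≤ (1 - r) / (1 + r) := div_nonneg (by linarith) (by linarith)
  nlinarith [Real.pi_pos]

/-- The kernel decreases in `|x|` on `[-π, π]`, so `x` times its derivative is nonpositive there. -/
lemma abs_deriv_angularKernel_mul_abs {r x : ℝ} (hr0 : 0 < r) (hr1 : r < 1)
    (hx : x ∈ Icc (-Real.pi) Real.pi) :
    |-((1 - r ^ 2) * (2 * r * Real.sin x)) / (1 - 2 * r * Real.cos x + r ^ 2) ^ 2| * |x| =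
      -(x * (-((1 - r ^ 2) * (2 * r * Real.sin x)) /
        (1 - 2 * r * Real.cos x + r ^ 2) ^ 2)) := by
  have h1 : 0 ≤ 1 - r ^ 2 := by nlinarith
  have hs : 0 ≤ x * Real.sin x := by
    rcases le_total 0 x with h | h
    · exact mul_nonneg h (Real.sin_nonneg_of_nonneg_of_le_pi h hx.2)
    · exact mul_nonneg_of_nonpos_of_nonpos h
        (Real.sin_nonpos_of_nonpos_of_neg_pi_le h hx.1)
  rw [← abs_mul, mul_comm _ x, ← abs_neg, abs_of_nonneg]
  rw [neg_div, mul_neg, neg_neg, ← mul_div_assoc]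
  apply div_nonneg _ (by positivity)
  nlinarith [mul_nonneg (mul_nonneg h1 hr0.le) hs]

/-- The denominator is `(1 - r)² + 2r (1 - cos x) ≥ 2r (1 - cos x)`, so the weight cancels its
square, leaving a bound that vanishes as `r → 1`. -/
lemma abs_deriv_angularKernel_mul_sq_le {r : ℝ} (hr0 : 0 < r) (hr1 : r < 1) (x : ℝ) :
    |-((1 - r ^ 2) * (2 * r * Real.sin x)) / (1 - 2 * r * Real.cos x + r ^ 2) ^ 2| *
      (1 - Real.cos x) ^ 2 ≤ (1 - r ^ 2) / (2 * r) := by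
  have h1 : 0 ≤ 1 - r ^ 2 := by nlinarith
  have hD := angularKernel_denom_pos hr0 hr1 x
  have hc : 0 ≤ 1 - Real.cos x := by linarith [Real.cos_le_one x]
  have hDc : 2 * r * (1 - Real.cos x) ≤ 1 - 2 * r * Real.cos x + r ^ 2 := by nlinarith
  rw [abs_div, abs_neg, abs_mul, abs_mul, abs_of_nonneg h1, abs_of_pos (by positivity : 0 < 2 * r),
    abs_of_pos (pow_pos hD 2), div_mul_eq_mul_div, div_le_div_iff₀ (by positivity) (by positivity)]
  have hsq : (2 * r * (1 - Real.cos x)) ^ 2 ≤ (1 - 2 * r * Real.cos x + r ^ 2) ^ 2 :=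
    pow_le_pow_left₀ (by positivity) hDc 2
  have hs := Real.abs_sin_le_one x
  calc (1 - r ^ 2) * (2 * r * |Real.sin x|) * (1 - Real.cos x) ^ 2 * (2 * r)
      = (1 - r ^ 2) * (|Real.sin x| * (2 * r * (1 - Real.cos x)) ^ 2) := by ring
    _ ≤ (1 - r ^ 2) * (1 * (1 - 2 * r * Real.cos x + r ^ 2) ^ 2) := by gcongr
    _ = _ := by ring

/-- A function that is `o(x)` at the origin is `ε |x|` up to a term of higher order. -/
lemma exists_abs_le_mul_abs_add_mul_sq {F : ℝ → ℝ}
    (hF : ContinuousOn F (Icc (-Real.pi) Real.pi)) (hF0 : F 0 = 0) (hd : HasDerivAt F 0 0)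
    {ε : ℝ} (hε : 0 < ε) :
    ∃ M : ℝ, 0 ≤ M ∧ ∀ x ∈ Icc (-Real.pi) Real.pi,
      |F x| ≤ ε * |x| + M * (1 - Real.cos x) ^ 2 := by
  obtain ⟨B, hB⟩ := isCompact_Icc.exists_bound_of_continuousOn hF
  have hB0 : 0 ≤ B := (norm_nonneg _).trans (hB 0 ⟨by linarith [Real.pi_pos], Real.pi_pos.le⟩)
  have hlo := (hasDerivAt_iff_isLittleO_nhds_zero.1 hd).def hε
  obtain ⟨δ, hδ, hball⟩ := Metric.eventually_nhds_iff.1 hlo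
  -- By `cos x ≤ 1 - 2x²/π²`, this is a lower bound for `1 - cos x` when `δ ≤ |x| ≤ π`; dividing the
  -- bound `B` by its square gives `M`.
  have hm : 0 < 2 / Real.pi ^ 2 * δ ^ 2 := by positivity
  refine ⟨B / (2 / Real.pi ^ 2 * δ ^ 2) ^ 2, by positivity, fun x hx => ?_⟩
  rcases lt_or_ge |x| δ with h | h
  · have := hball (y := x) (by simpa using h)
    simp [hF0] at this
    have : 0 ≤ B / (2 / Real.pi ^ 2 * δ ^ 2) ^ 2 * (1 - Real.cos x) ^ 2 := by positivity
    linarith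
  · have hq := Real.cos_le_one_sub_mul_cos_sq (abs_le.2 hx)
    have hx2 : δ ^ 2 ≤ x ^ 2 := by rw [← sq_abs x]; gcongr
    have h1 : 2 / Real.pi ^ 2 * δ ^ 2 ≤ 1 - Real.cos x := by
      have : 2 / Real.pi ^ 2 * δ ^ 2 ≤ 2 / Real.pi ^ 2 * x ^ 2 := by gcongr
      linarith
    have h2 : (2 / Real.pi ^ 2 * δ ^ 2) ^ 2 ≤ (1 - Real.cos x) ^ 2 := by gcongr
    have h3 : B ≤ B / (2 / Real.pi ^ 2 * δ ^ 2) ^ 2 * (1 - Real.cos x) ^ 2 := by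
      rw [div_mul_eq_mul_div, le_div_iff₀ (by positivity)]
      gcongr
    have h4 := hB x hx
    rw [Real.norm_eq_abs] at h4
    have : 0 ≤ ε * |x| := by positivity
    linarith

/-- Integrating by parts moves the derivative from `g`'s primitive `F` to the kernel. Since `F(x) =
o(x)`, the bound `|F| ≤ ε |x| + M (1 - cos x)²` splits the integral into a part of size `2π ε` and a
part that vanishes with `1 - r`. -/
lemma tendsto_integral_angularKernel_mul {g : ℝ → ℝ}
    (hg : IntervalIntegrable g volume (-Real.pi) Real.pi)
    (hd : HasDerivAt (fun x => ∫ y in (0 : ℝ)..x, g y) 0 0) :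
    Tendsto (fun r => ∫ x in (-Real.pi)..Real.pi, angularKernel r x * g x)
      (𝓝[<] (1 : ℝ)) (𝓝 0) := by
  set F : ℝ → ℝ := fun x => ∫ y in (0 : ℝ)..x, g y with hFdef
  have hpi := Real.pi_pos
  have hle : -Real.pi ≤ Real.pi := by linarith
  have h0 : (0 : ℝ) ∈ uIcc (-Real.pi) Real.pi := by
    rw [uIcc_of_le hle]; exact ⟨by linarith, hpi.le⟩
  have hFac : AbsolutelyContinuousOnInterval F (-Real.pi) Real.pi :=
    hg.absolutelyContinuousOnInterval_intervalIntegral h0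
  have hFc : ContinuousOn F (Icc (-Real.pi) Real.pi) := by
    have := hFac.continuousOn
    rwa [uIcc_of_le hle] at this
  have hF' : ∀ᵐ x, x ∈ uIcc (-Real.pi) Real.pi → deriv F x = g x := by
    filter_upwards [hg.ae_hasDerivAt_integral] with x hx hxm
    exact (hx hxm 0 h0).deriv
  have key (r : ℝ) (hr0 : 0 < r) (hr1 : r < 1) (ε M : ℝ) (hε : 0 < ε) (hM0 : 0 ≤ M)
      (hM : ∀ x ∈ Icc (-Real.pi) Real.pi, |F x| ≤ ε * |x| + M * (1 - Real.cos x) ^ 2) :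
      |∫ x in (-Real.pi)..Real.pi, angularKernel r x * g x| ≤
        (1 - r) / (1 + r) * |F Real.pi - F (-Real.pi)| + (ε * (2 * Real.pi) +
          M * ((1 - r ^ 2) / (2 * r)) * (2 * Real.pi)) := by
    have hkd : ContDiff ℝ 1 (angularKernel r) := by
      refine contDiff_one_iff_deriv.2 ⟨fun x =>
        (hasDerivAt_angularKernel hr0 hr1 x).differentiableAt, ?_⟩
      rw [funext fun x => (hasDerivAt_angularKernel hr0 hr1 x).deriv]
      exact continuous_deriv_angularKernel hr0 hr1
    have hkac : AbsolutelyContinuousOnInterval (angularKernel r) (-Real.pi) Real.pi :=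
      hkd.contDiffOn.absolutelyContinuousOnInterval
    have h1 : ∫ x in (-Real.pi)..Real.pi, angularKernel r x * g x =
        ∫ x in (-Real.pi)..Real.pi, angularKernel r x * deriv F x := by
      apply intervalIntegral.integral_congr_ae
      filter_upwards [hF'] with x hx hxm
      rw [hx (uIoc_subset_uIcc hxm)]
    rw [h1, hkac.integral_mul_deriv_eq_deriv_mul hFac, angularKernel_neg, angularKernel_pi hr0,
      ← mul_sub]
    refine (abs_sub _ _).trans (add_le_add ?_ ?_)
    · rw [abs_mul, abs_of_nonneg (div_nonneg (by linarith) (by linarith))]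
    set k : ℝ → ℝ := fun x => -((1 - r ^ 2) * (2 * r * Real.sin x)) /
      (1 - 2 * r * Real.cos x + r ^ 2) ^ 2 with hk
    have hkc : Continuous k := continuous_deriv_angularKernel hr0 hr1
    rw [funext fun x => (hasDerivAt_angularKernel hr0 hr1 x).deriv]
    have hb : ∀ x ∈ Icc (-Real.pi) Real.pi,
        |k x * F x| ≤ ε * (-(x * k x)) + M * ((1 - r ^ 2) / (2 * r)) := by
      intro x hx
      rw [abs_mul]
      calc |k x| * |F x| ≤ |k x| * (ε * |x| + M * (1 - Real.cos x) ^ 2) := by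
            gcongr; exact hM x hx
        _ = ε * (|k x| * |x|) + M * (|k x| * (1 - Real.cos x) ^ 2) := by ring
        _ ≤ _ := by
            rw [abs_deriv_angularKernel_mul_abs hr0 hr1 hx]
            gcongr
            exact abs_deriv_angularKernel_mul_sq_le hr0 hr1 x
    have hi1 : IntervalIntegrable (fun x => ε * (-(x * k x))) volume (-Real.pi) Real.pi :=
      (by fun_prop : Continuous fun x => ε * (-(x * k x))).intervalIntegrable _ _
    refine (intervalIntegral.abs_integral_le_integral_abs hle).trans ?_
    calc ∫ x in (-Real.pi)..Real.pi, |k x * F x|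
        ≤ ∫ x in (-Real.pi)..Real.pi, (ε * (-(x * k x)) + M * ((1 - r ^ 2) / (2 * r))) := by
          refine intervalIntegral.integral_mono_on hle ?_ (hi1.add intervalIntegrable_const) hb
          refine IntervalIntegrable.abs ?_
          apply ContinuousOn.intervalIntegrable
          rw [uIcc_of_le hle]
          exact hkc.continuousOn.mul hFc
      _ = ε * (∫ x in (-Real.pi)..Real.pi, -(x * k x)) +
          M * ((1 - r ^ 2) / (2 * r)) * (2 * Real.pi) := by
          rw [intervalIntegral.integral_add hi1 intervalIntegrable_const,
            intervalIntegral.integral_const_mul, intervalIntegral.integral_const, smul_eq_mul]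
          ring
      _ ≤ _ := by
          gcongr
          exact integral_neg_mul_deriv_angularKernel_le hr0 hr1
  rw [Metric.tendsto_nhds]
  intro η hη
  set ε : ℝ := η / (4 * Real.pi) with hεdef
  have hε : 0 < ε := by positivity
  obtain ⟨M, hM0, hM⟩ := exists_abs_le_mul_abs_add_mul_sq hFc (by simp [hFdef]) hd hε
  have hlim : Tendsto (fun r : ℝ => (1 - r) / (1 + r) * |F Real.pi - F (-Real.pi)| +
      (ε * (2 * Real.pi) + M * ((1 - r ^ 2) / (2 * r)) * (2 * Real.pi))) (𝓝[<] (1 : ℝ))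
      (𝓝 (η / 2)) := by
    have hc : ContinuousAt (fun r : ℝ => (1 - r) / (1 + r) * |F Real.pi - F (-Real.pi)| +
        (ε * (2 * Real.pi) + M * ((1 - r ^ 2) / (2 * r)) * (2 * Real.pi))) 1 := by
      refine ContinuousAt.add (.mul (.div (by fun_prop) (by fun_prop) (by norm_num)) (by fun_prop))
        (.add (by fun_prop) (.mul (.mul (by fun_prop)
          (.div (by fun_prop) (by fun_prop) (by norm_num))) (by fun_prop)))
    have := hc.tendsto
    have he : ε * (2 * Real.pi) = η / 2 := by rw [hεdef]; field_simp; ring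
    simp only [sub_self, zero_div, zero_mul, one_pow, mul_zero, add_zero, zero_add, he] at this
    simp only [he]
    exact this.mono_left nhdsWithin_le_nhds
  filter_upwards [hlim.eventually_lt_const (half_lt_self hη), eventually_pos_nhdsLT_one,
    self_mem_nhdsWithin] with r h1 h2 h3
  rw [Real.dist_0_eq_abs]
  exact (key r h2 h3 ε M hε hM0 hM).trans_lt h1

/-- **Fatou's theorem**: the Poisson integral of an integrable function has it as its radial limit
almost everywhere. -/
theorem ae_tendsto_poissonInt {h : DiskBoundary → ℝ} (hh : Integrable h boundaryMeasure) :
    ∀ᵐ s : DiskBoundary ∂boundaryMeasure,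
      Tendsto (fun r : ℝ => poissonInt h ((r : ℂ) * s)) (𝓝[<] (1 : ℝ)) (𝓝 (h s)) := by
  rw [ae_boundaryMeasure_iff, ae_restrict_iff' measurableSet_Ioc]
  set g : ℝ → ℝ := fun θ => h (expPoint θ) with hg
  have hper : Function.Periodic g (2 * Real.pi) := fun x => by
    simp only [hg, expPoint_add_two_pi]
  have hgi (a b : ℝ) : IntervalIntegrable g volume a b :=
    hper.intervalIntegrable₀ Real.two_pi_pos.ne' (integrable_boundaryMeasure_iff.1 hh) a b
  -- Lebesgue differentiation selects the good points: there the primitive of `g - g θ₀` has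
  -- derivative zero.
  filter_upwards [(hgi 0 (2 * Real.pi)).ae_hasDerivAt_integral] with θ₀ hθ hmem
  have hmem' : θ₀ ∈ uIcc 0 (2 * Real.pi) := by
    rw [uIcc_of_le Real.two_pi_pos.le]; exact Ioc_subset_Icc_self hmem
  have hd := hθ hmem' θ₀ hmem'
  have hgi' : IntervalIntegrable (fun x => g (x + θ₀)) volume (-Real.pi) Real.pi := by
    have := (hgi (-Real.pi + θ₀) (Real.pi + θ₀)).comp_add_right θ₀
    simpa using this
  have hd' : HasDerivAt (fun x => ∫ y in (0 : ℝ)..x, (g (y + θ₀) - g θ₀)) 0 0 := by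
    have h1 : HasDerivAt (fun x : ℝ => (∫ y in θ₀..(x + θ₀), g y) - x * g θ₀)
        (g θ₀ - 1 * g θ₀) 0 := by
      refine HasDerivAt.sub ?_ ((hasDerivAt_id (0 : ℝ)).mul_const (g θ₀))
      have : HasDerivAt (fun x => ∫ y in θ₀..x, g y) (g θ₀) (0 + θ₀) := by simpa using hd
      exact this.comp_add_const 0 θ₀
    rw [one_mul, sub_self] at h1
    refine h1.congr_of_eventuallyEq (.of_forall fun x => ?_)
    have h2 : IntervalIntegrable (fun x => g (x + θ₀)) volume 0 x := by
      have := (hgi (0 + θ₀) (x + θ₀)).comp_add_right θ₀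
      simpa using this
    simp only
    rw [intervalIntegral.integral_sub h2 intervalIntegrable_const,
      intervalIntegral.integral_comp_add_right g θ₀, intervalIntegral.integral_const]
    simp
  have hlim := tendsto_integral_angularKernel_mul (hgi'.sub intervalIntegrable_const) hd'
  have hlim2 := (hlim.const_mul (2 * Real.pi)⁻¹).add_const (g θ₀)
  rw [mul_zero, zero_add] at hlim2
  refine hlim2.congr' ?_
  filter_upwards [eventually_pos_nhdsLT_one, self_mem_nhdsWithin] with r hr0 hr1
  rw [poissonInt_eq_integral_angularKernel]
  simp only [mul_sub]
  have hk := continuous_angularKernel hr0 hr1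
  have hki : IntervalIntegrable (fun x => angularKernel r x * g θ₀) volume (-Real.pi) Real.pi :=
    (hk.mul continuous_const).intervalIntegrable _ _
  rw [intervalIntegral.integral_sub (hgi'.continuousOn_mul hk.continuousOn) hki,
    intervalIntegral.integral_mul_const, integral_angularKernel hr0 hr1, mul_sub]
  have : (2 * Real.pi) ≠ 0 := by positivity
  field_simp
  ring

/-! ### Poisson majorants of subharmonic functions -/

/-- The maximum principle on the closed unit disk, for upper semicontinuous functions with the
sub-mean value inequality on all closed disks. -/
lemma nonpos_of_submean {u : ℂ → ℝ} (husc : UpperSemicontinuousOn u (closedBall 0 1))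
    (hsub : ∀ t τ : ℂ, (∀ ζ : ℂ, ‖ζ‖ ≤ 1 → ‖t + ζ * τ‖ ≤ 1) →
      CircleIntegrable (fun ζ => u (t + ζ * τ)) 0 1 ∧
        u t ≤ Real.circleAverage (fun ζ => u (t + ζ * τ)) 0 1)
    (hbd : ∀ s ∈ sphere (0 : ℂ) 1, u s ≤ 0) {t : ℂ} (ht : t ∈ closedBall (0 : ℂ) 1) :
    u t ≤ 0 := by
  obtain ⟨t₀, ht₀, hmax⟩ := husc.exists_isMaxOn ⟨t, ht⟩ (isCompact_closedBall 0 1)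
  suffices h : u t₀ ≤ 0 from (hmax ht).trans h
  by_contra! hpos
  -- The disc of radius `ρ` about the maximum point touches the unit circle at `e`, where `u ≤ 0 < u
  -- t₀`. The sub-mean inequality forces `u = u t₀` almost everywhere on its boundary, which upper
  -- semicontinuity at `e` contradicts.
  set ρ : ℝ := 1 - ‖t₀‖ with hρ
  have hρ0 : 0 ≤ ρ := by
    rw [mem_closedBall_zero_iff] at ht₀; linarith
  obtain ⟨e, he, het⟩ : ∃ e : ℂ, ‖e‖ = 1 ∧ t₀ = ‖t₀‖ * e := by
    by_cases h0 : t₀ = 0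
    · exact ⟨1, by simp, by simp [h0]⟩
    · refine ⟨t₀ / ‖t₀‖, by simp [h0], ?_⟩
      have : (‖t₀‖ : ℂ) ≠ 0 := by simpa using h0
      field_simp
  have hin (ζ : ℂ) (hζ : ‖ζ‖ ≤ 1) : ‖t₀ + ζ * ρ‖ ≤ 1 := by
    refine (norm_add_le _ _).trans ?_
    rw [norm_mul, Complex.norm_real, Real.norm_of_nonneg hρ0]
    nlinarith
  obtain ⟨hint, hle⟩ := hsub t₀ ρ hin
  have hetouch : t₀ + e * ρ = e := by
    rw [hρ]; push_cast; linear_combination het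
  set v : DiskBoundary → ℝ := fun s => u (t₀ + s * ρ) with hv
  have hvle (s : DiskBoundary) : v s ≤ u t₀ :=
    hmax (mem_closedBall_zero_iff.2 (hin s (norm_coe_diskBoundary s).le))
  have hvi : Integrable v boundaryMeasure := by
    rw [integrable_boundaryMeasure_iff]
    simp only [hv, coe_expPoint]
    exact hint
  rw [← integral_boundaryMeasure_eq_circleAverage] at hle
  have hsub0 : ∫ s, (u t₀ - v s) ∂boundaryMeasure ≤ 0 := by
    rw [integral_sub (integrable_const _) hvi]
    simpa using hle
  have hae : (fun s => u t₀ - v s) =ᵐ[boundaryMeasure] 0 := by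
    rw [← integral_eq_zero_iff_of_nonneg (fun s => sub_nonneg.2 (hvle s))
      ((integrable_const _).sub hvi)]
    exact le_antisymm hsub0 (integral_nonneg fun s => sub_nonneg.2 (hvle s))
  have hnear : ∀ᶠ s in 𝓝 (⟨e, by simp [he]⟩ : DiskBoundary), v s < u t₀ := by
    have hlt : u e < u t₀ := (hbd e (by simp [he])).trans_lt hpos
    have h1 := husc e (by simp [he]) _ hlt
    have hcont : Tendsto (fun s : DiskBoundary => t₀ + s * ρ)
        (𝓝 (⟨e, by simp [he]⟩ : DiskBoundary)) (𝓝[closedBall 0 1] e) := by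
      refine tendsto_nhdsWithin_iff.2 ⟨?_, .of_forall fun s =>
        mem_closedBall_zero_iff.2 (hin s (norm_coe_diskBoundary s).le)⟩
      have hc : Continuous (fun s : DiskBoundary => t₀ + (s : ℂ) * ρ) := by fun_prop
      have := hc.tendsto (⟨e, by simp [he]⟩ : DiskBoundary)
      simp only [hetouch] at this
      exact this
    exact hcont.eventually h1
  obtain ⟨θ, hθ⟩ := exists_expPoint_eq ⟨e, by simp [he]⟩
  rw [← hθ] at hnear
  have hnear2 := continuous_expPoint.continuousAt.eventually hnear
  obtain ⟨δ, hδ, hball⟩ := Metric.eventually_nhds_iff.1 hnear2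
  have hae2 := ae_boundaryMeasure_iff.1 hae
  set k : ℝ := toIocMod Real.two_pi_pos 0 θ with hk
  have hkmem := toIocMod_mem_Ioc Real.two_pi_pos 0 θ
  rw [← hk, zero_add] at hkmem
  have hkθ : k = θ - toIocDiv Real.two_pi_pos 0 θ * (2 * Real.pi) := by
    rw [hk, toIocMod, zsmul_eq_mul]
  have hper : Function.Periodic (fun θ => v (expPoint θ)) (2 * Real.pi) := fun x => by
    simp only [expPoint_add_two_pi]
  -- Only an interval to the left of `k` is used: `k` may equal `2π`, while `(a, k)` always stays in
  -- `(0, 2π]`.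
  set a : ℝ := max 0 (k - δ) with ha
  have hak : a < k := max_lt hkmem.1 (by linarith)
  have hvol : (volume.restrict (Ioc 0 (2 * Real.pi))) (Ioo a k) ≠ 0 := by
    rw [Measure.restrict_apply measurableSet_Ioo, inter_eq_left.2, Real.volume_Ioo]
    · simpa using hak
    · intro x hx
      exact ⟨(le_max_left _ _).trans_lt hx.1, hx.2.le.trans hkmem.2⟩
  refine hvol (measure_mono_null ?_ hae2)
  intro x hx
  have hxδ : k - δ < x := (le_max_right _ _).trans_lt hx.1
  have h1 : v (expPoint x) < u t₀ := by
    have h2 := hper.int_mul (toIocDiv Real.two_pi_pos 0 θ) x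
    rw [← h2]
    apply hball
    rw [Real.dist_eq, abs_lt]
    constructor <;> linarith [hx.2]
  have : u t₀ - v (expPoint x) ≠ 0 := by linarith
  simpa using this

/-- Real parts of trigonometric polynomials are boundary values of real parts of entire functions. -/
lemma exists_entire_re_of_mem_span_fourier {q : C(AddCircle (2 * Real.pi), ℂ)}
    (hq : q ∈ Submodule.span ℂ (range (@fourier (2 * Real.pi)))) (c : ℂ) :
    ∃ G : ℂ → ℂ, Differentiable ℂ G ∧ ∀ θ : ℝ, (c * q θ).re = (G (expPoint θ)).re := by
  -- The factor `c` absorbs complex scalars, through which the real part does not commute. Negative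
  -- frequencies are conjugated: `Re (c e^{-imθ}) = Re (c̄ e^{imθ})`.
  induction hq using Submodule.span_induction generalizing c with
  | mem x hx =>
    obtain ⟨n, rfl⟩ := hx
    have hexp (θ : ℝ) : (fourier n (θ : AddCircle (2 * Real.pi)) : ℂ) =
        Complex.exp (θ * Complex.I) ^ n := by
      rw [fourier_coe_apply, ← Complex.exp_int_mul]
      congr 1
      have : (Real.pi : ℂ) ≠ 0 := by exact_mod_cast Real.pi_ne_zero
      push_cast
      field_simp
    obtain ⟨m, rfl | rfl⟩ := n.eq_nat_or_neg
    · refine ⟨fun z => c * z ^ m, by fun_prop, fun θ => ?_⟩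
      rw [hexp, zpow_natCast]; rfl
    · refine ⟨fun z => starRingEnd ℂ c * z ^ m, by fun_prop, fun θ => ?_⟩
      rw [hexp, ← Complex.conj_re]
      congr 1
      simp only [expPoint, map_mul, zpow_neg, zpow_natCast, map_inv₀, map_pow]
      rw [← Complex.exp_conj, ← Complex.exp_nat_mul, ← Complex.exp_nat_mul, ← Complex.exp_neg]
      simp
  | zero => exact ⟨fun _ => 0, by fun_prop, fun θ => by simp⟩
  | add x y _ _ hx hy =>
    obtain ⟨G, hG, hGx⟩ := hx c
    obtain ⟨H, hH, hHy⟩ := hy c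
    refine ⟨fun z => G z + H z, by fun_prop, fun θ => ?_⟩
    rw [ContinuousMap.add_apply, mul_add, Complex.add_re, Complex.add_re, hGx, hHy]
  | smul a x _ hx =>
    obtain ⟨G, hG, hGx⟩ := hx (c * a)
    refine ⟨G, hG, fun θ => ?_⟩
    rw [← hGx, ContinuousMap.smul_apply, smul_eq_mul, mul_assoc]

/-- Continuous functions on the circle are uniform limits of real parts of entire functions. -/
lemma exists_entire_re_approx (h : C(DiskBoundary, ℝ)) {ε : ℝ} (hε : 0 < ε) :
    ∃ G : ℂ → ℂ, Differentiable ℂ G ∧ ∀ s : DiskBoundary, |(G s).re - h s| < ε := by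
  have : Fact (0 < 2 * Real.pi) := ⟨Real.two_pi_pos⟩
  have hper : Function.Periodic (fun θ => (h (expPoint θ) : ℂ)) (2 * Real.pi) := fun x => by
    simp only [expPoint_add_two_pi]
  let h' : C(AddCircle (2 * Real.pi), ℂ) := ⟨hper.lift, by
    have hc : Continuous fun θ => (h (expPoint θ) : ℂ) :=
      Complex.continuous_ofReal.comp (h.continuous.comp continuous_expPoint)
    exact hc.quotient_liftOn' _⟩
  have hmem : h' ∈ (Submodule.span ℂ (range (@fourier (2 * Real.pi)))).topologicalClosure := by
    rw [span_fourier_closure_eq_top]; trivial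
  obtain ⟨q, hq, hdist⟩ := Metric.mem_closure_iff.1 hmem ε hε
  obtain ⟨G, hG, hGq⟩ := exists_entire_re_of_mem_span_fourier hq 1
  refine ⟨G, hG, fun s => ?_⟩
  obtain ⟨θ, rfl⟩ := exists_expPoint_eq s
  rw [← hGq θ, one_mul]
  have h1 := (ContinuousMap.dist_apply_le_dist (f := h') (g := q) (θ : AddCircle _)).trans_lt hdist
  have h2 : h' (θ : AddCircle (2 * Real.pi)) = (h (expPoint θ) : ℂ) := rfl
  rw [h2, dist_comm, dist_eq_norm] at h1
  refine lt_of_le_of_lt ?_ h1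
  have := Complex.abs_re_le_norm (q θ - (h (expPoint θ) : ℂ))
  simpa using this

/-- An upper semicontinuous function with the sub-mean value inequality on the closed unit disk is
at most the Poisson integral of any integrable majorant of its boundary values. -/
lemma le_poissonInt_of_submean {u : ℂ → ℝ} (husc : UpperSemicontinuousOn u (closedBall 0 1))
    (hsub : ∀ t τ : ℂ, (∀ ζ : ℂ, ‖ζ‖ ≤ 1 → ‖t + ζ * τ‖ ≤ 1) →
      CircleIntegrable (fun ζ => u (t + ζ * τ)) 0 1 ∧
        u t ≤ Real.circleAverage (fun ζ => u (t + ζ * τ)) 0 1)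
    {v : DiskBoundary → ℝ} (hv : Integrable v boundaryMeasure)
    (huv : ∀ s : DiskBoundary, u s ≤ v s) {t : ℂ} (ht : t ∈ ball (0 : ℂ) 1) :
    u t ≤ poissonInt v t := by
  have hm : 0 < 1 - ‖t‖ := by rw [mem_ball_zero_iff] at ht; linarith
  have key (ε : ℝ) (hε : 0 < ε) : u t ≤ poissonInt v t + (2 / (1 - ‖t‖) + 2) * ε := by
    -- Vitali–Carathéodory: a lower semicontinuous `g > v` with nearly the same integral. A
    -- continuous `h` fits between the upper semicontinuous `u` and `g`, and is then approximated by
    -- the real part of an entire function.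
    obtain ⟨g, hvg, hglsc, hgi, hgtop, hgint⟩ := exists_lt_lowerSemicontinuous_integral_lt v hv hε
    have huscs : UpperSemicontinuous fun s : DiskBoundary => u s := by
      intro s y hy
      have h1 := husc s (by simp) y hy
      have h2 : Tendsto (fun s : DiskBoundary => (s : ℂ)) (𝓝 s) (𝓝[closedBall 0 1] (s : ℂ)) :=
        tendsto_nhdsWithin_iff.2 ⟨continuous_subtype_val.tendsto s,
          .of_forall fun s => by simp⟩
      exact h2.eventually h1
    obtain ⟨h, hh⟩ := exists_continuous_forall_mem_convex_of_local_const
      (t := fun s : DiskBoundary => {y : ℝ | u s < y ∧ (y : EReal) < g s})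
      (fun s => by
        refine convex_iff_ordConnected.2 ⟨fun x hx y hy z hz => ⟨hx.1.trans_le hz.1, ?_⟩⟩
        exact (EReal.coe_le_coe_iff.2 hz.2).trans_lt hy.2)
      (fun s => by
        have hlt : (u s : EReal) < g s := (EReal.coe_le_coe_iff.2 (huv s)).trans_lt (hvg s)
        obtain ⟨c, hc1, hc2⟩ := EReal.lt_iff_exists_real_btwn.1 hlt
        refine ⟨c, ?_⟩
        filter_upwards [huscs s c (EReal.coe_lt_coe_iff.1 hc1), hglsc s c hc2] with y h1 h2
        exact ⟨h1, h2⟩)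
    obtain ⟨G, hG, hGh⟩ := exists_entire_re_approx h hε
    have hcomp : u t - (G t).re - ε ≤ 0 := by
      refine nonpos_of_submean (u := fun t => u t - (G t).re - ε) ?_ ?_ ?_
        (ball_subset_closedBall ht)
      · have hc : Continuous fun t => -(G t).re - ε :=
          ((Complex.continuous_re.comp hG.continuous).neg).sub continuous_const
        have hfun : (fun t => u t - (G t).re - ε) = fun t => u t + (-(G t).re - ε) := by
          ext x; ring
        rw [hfun]
        exact husc.add hc.continuousOn.upperSemicontinuousOn
      · intro a τ haτ
        obtain ⟨hi, hle⟩ := hsub a τ haτ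
        have hGd : Differentiable ℂ fun ζ => G (a + ζ * τ) + ε :=
          (hG.comp (by fun_prop)).add_const _
        have hgi : CircleIntegrable (fun ζ => (G (a + ζ * τ)).re + ε) 0 1 := by
          apply ContinuousOn.circleIntegrable'
          have := Complex.continuous_re.comp hGd.continuous
          simp only [Function.comp_def, Complex.add_re, Complex.ofReal_re] at this
          exact this.continuousOn
        have hav : Real.circleAverage (fun ζ => (G (a + ζ * τ)).re + ε) 0 1 = (G a).re + ε := by
          have h1 := hGd.diffContOnCl.circleAverage (c := 0) (R := 1)
          have h2 := Complex.reCLM.circleAverage_comp_comm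
            (hGd.continuous.continuousOn.circleIntegrable' (c := 0) (R := 1))
          rw [h1] at h2
          simpa [Function.comp_def] using h2
        have hfun : (fun ζ => u (a + ζ * τ) - (G (a + ζ * τ)).re - ε) =
            fun ζ => u (a + ζ * τ) - ((G (a + ζ * τ)).re + ε) := by
          ext ζ; ring
        rw [hfun, Real.circleAverage_fun_sub hi hgi, hav]
        exact ⟨hi.sub hgi, by linarith⟩
      · intro s hs
        have h1 := (abs_lt.1 (hGh ⟨s, hs⟩)).1
        have h2 := (hh ⟨s, hs⟩).1
        simp only at h1 h2
        linarith
    set w : DiskBoundary → ℝ := fun s => (g s).toReal with hw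
    have hGi : Integrable (fun s : DiskBoundary => (G s).re) boundaryMeasure := by
      rw [integrable_boundaryMeasure_iff]
      exact ((Complex.continuous_re.comp hG.continuous).comp
        (continuous_subtype_val.comp continuous_expPoint)).intervalIntegrable _ _
    have hvw : ∀ᵐ s ∂boundaryMeasure, v s ≤ w s := by
      filter_upwards [hgtop] with s hs
      have h1 : (v s : EReal) ≤ g s := (hvg s).le
      have h2 := EReal.toReal_le_toReal h1 (EReal.coe_ne_bot _) hs.ne
      simpa using h2
    have h1 : poissonInt (fun s : DiskBoundary => (G s).re) t ≤ poissonInt (fun s => w s + ε) t := by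
      refine poissonInt_mono ht hGi (hgi.add (integrable_const ε)) ?_
      filter_upwards [hgtop] with s hs
      have h1 := (abs_lt.1 (hGh s)).2
      have h2 : ((h s : ℝ) : EReal) ≤ g s := (hh s).2.le
      have h3 := EReal.toReal_le_toReal h2 (EReal.coe_ne_bot _) hs.ne
      simp only [EReal.toReal_coe] at h3
      simp only [hw]
      linarith
    rw [poissonInt_re_eq hG ht, poissonInt_add ht hgi (integrable_const ε),
      poissonInt_const ht] at h1
    have h2 : poissonInt w t - poissonInt v t ≤ 2 / (1 - ‖t‖) * ε := by
      rw [← poissonInt_sub ht hgi hv, poissonInt]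
      calc ∫ s : DiskBoundary, poissonKernel 0 t s • (w s - v s) ∂boundaryMeasure
          ≤ ∫ s : DiskBoundary, 2 / (1 - ‖t‖) * (w s - v s) ∂boundaryMeasure := by
            refine integral_mono_ae (integrable_poissonKernel_smul ht (hgi.sub hv))
              ((hgi.sub hv).const_mul _) ?_
            filter_upwards [hvw] with s hs
            exact mul_le_mul_of_nonneg_right (poissonKernel_le_two_div ht s) (sub_nonneg.2 hs)
        _ ≤ _ := by
            rw [integral_const_mul, integral_sub hgi hv]
            gcongr
            linarith
    linarith
  have hK : 0 < 2 / (1 - ‖t‖) + 2 := by positivity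
  refine le_of_forall_pos_le_add fun η hη => ?_
  have := key (η / (2 / (1 - ‖t‖) + 2)) (by positivity)
  rwa [mul_div_cancel₀ _ hK.ne'] at this

/-- A bounded above subharmonic function on the open disk is at most the Poisson integral of any
bounded measurable majorant of its radial upper limits. -/
lemma le_poissonInt_of_radial {u : ℂ → ℝ} (husc : UpperSemicontinuousOn u (ball 0 1))
    (hsub : ∀ t τ : ℂ, (∀ ζ : ℂ, ‖ζ‖ ≤ 1 → ‖t + ζ * τ‖ < 1) →
      CircleIntegrable (fun ζ => u (t + ζ * τ)) 0 1 ∧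
        u t ≤ Real.circleAverage (fun ζ => u (t + ζ * τ)) 0 1)
    {g : DiskBoundary → ℝ} (hg : Measurable g) {M : ℝ} (hgM : ∀ s, |g s| ≤ M)
    (huM : ∀ t ∈ ball (0 : ℂ) 1, u t ≤ M)
    (hlim : ∀ᵐ s : DiskBoundary ∂boundaryMeasure, ∀ ε > 0,
      ∀ᶠ r : ℝ in 𝓝[<] 1, u (r * s) < g s + ε) {t : ℂ} (ht : t ∈ ball (0 : ℂ) 1) :
    u t ≤ poissonInt g t := by
  have ht1 := mem_ball_zero_iff.1 ht
  -- The majorant is applied to `u (ρ ·)` at `t / ρ`; for `ρ` near `1` these points stay in `|z| <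
  -- b`, which bounds the Poisson kernels uniformly.
  set b : ℝ := (1 + ‖t‖) / 2 with hb
  have hb1 : b < 1 := by rw [hb]; linarith
  have htb : ‖t‖ < b := by rw [hb]; linarith
  have hb0 : 0 < b := (norm_nonneg t).trans_lt htb
  have hgi : Integrable g boundaryMeasure :=
    Integrable.of_bound hg.aestronglyMeasurable M (ae_of_all _ hgM)
  -- The maximum with `g` supplies the lower bound that `u` may lack, so dominated convergence
  -- applies; the upper-limit hypothesis gives `v ρ → g` almost everywhere.
  set v : ℝ → DiskBoundary → ℝ := fun ρ s => max (u (ρ * s)) (g s) with hv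
  have hnorm (ρ : ℝ) (h0 : 0 < ρ) (z : ℂ) : ‖(ρ : ℂ) * z‖ = ρ * ‖z‖ := by
    rw [norm_mul, Complex.norm_real, Real.norm_of_nonneg h0.le]
  have hmaps (ρ : ℝ) (h0 : 0 < ρ) (h1 : ρ < 1) :
      MapsTo (fun ζ : ℂ => (ρ : ℂ) * ζ) (closedBall 0 1) (ball 0 1) := fun ζ hζ => by
    rw [mem_closedBall_zero_iff] at hζ
    rw [mem_ball_zero_iff, hnorm ρ h0]
    nlinarith
  have huscρ (ρ : ℝ) (h0 : 0 < ρ) (h1 : ρ < 1) :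
      UpperSemicontinuousOn (fun ζ => u (ρ * ζ)) (closedBall 0 1) := by
    intro x hx y hy
    have hc : Continuous fun ζ : ℂ => (ρ : ℂ) * ζ := by fun_prop
    have h2 : Tendsto (fun ζ : ℂ => (ρ : ℂ) * ζ) (𝓝[closedBall 0 1] x) (𝓝[ball 0 1] (ρ * x)) :=
      hc.continuousWithinAt.tendsto_nhdsWithin (hmaps ρ h0 h1)
    exact h2.eventually (husc _ (hmaps ρ h0 h1 hx) y hy)
  have hvm (ρ : ℝ) (h0 : 0 < ρ) (h1 : ρ < 1) : Measurable (v ρ) := by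
    refine Measurable.max (UpperSemicontinuous.measurable ?_) hg
    intro s y hy
    exact (tendsto_nhdsWithin_iff.2 ⟨continuous_subtype_val.tendsto s, .of_forall fun s =>
      by simp⟩).eventually (huscρ ρ h0 h1 s (by simp) y hy)
  have hvb (ρ : ℝ) (h0 : 0 < ρ) (h1 : ρ < 1) (s : DiskBoundary) : |v ρ s| ≤ M :=
    abs_le.2 ⟨(abs_le.1 (hgM s)).1.trans (le_max_right _ _),
      max_le (huM _ (hmaps ρ h0 h1 (by simp))) (abs_le.1 (hgM s)).2⟩
  have hlt : ∀ᶠ ρ : ℝ in 𝓝[<] (1 : ℝ), ‖t / (ρ : ℂ)‖ < b := by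
    have hc : ContinuousAt (fun ρ : ℝ => ‖t / (ρ : ℂ)‖) 1 :=
      (continuousAt_const.div Complex.continuous_ofReal.continuousAt (by simp)).norm
    have := hc.tendsto.eventually_lt_const (u := b) (by simpa using htb)
    exact this.filter_mono nhdsWithin_le_nhds
  have hlim' : Tendsto (fun ρ : ℝ => poissonInt (v ρ) (t / ρ)) (𝓝[<] (1 : ℝ))
      (𝓝 (poissonInt g t)) := by
    refine tendsto_integral_filter_of_dominated_convergence (fun _ => 2 / (1 - b) * M) ?_ ?_
      (integrable_const _) ?_
    · filter_upwards [eventually_pos_nhdsLT_one, self_mem_nhdsWithin, hlt] with ρ h0 h1 h2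
      have hmem : t / (ρ : ℂ) ∈ ball (0 : ℂ) 1 := mem_ball_zero_iff.2 (h2.trans hb1)
      exact ((continuous_poissonKernel hmem).measurable.mul (hvm ρ h0 h1)).aestronglyMeasurable
    · filter_upwards [eventually_pos_nhdsLT_one, self_mem_nhdsWithin, hlt] with ρ h0 h1 h2
      refine ae_of_all _ fun s => ?_
      have hmem : t / (ρ : ℂ) ∈ ball (0 : ℂ) 1 := mem_ball_zero_iff.2 (h2.trans hb1)
      rw [norm_smul, Real.norm_of_nonneg (poissonKernel_nonneg hmem s), Real.norm_eq_abs]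
      have hb' : 0 < 1 - b := by linarith
      refine mul_le_mul ((poissonKernel_le_two_div hmem s).trans ?_) (hvb ρ h0 h1 s)
        (abs_nonneg _) (by positivity)
      gcongr
    · filter_upwards [hlim] with s hs
      refine Tendsto.smul ?_ ?_
      · have hc : ContinuousAt (fun ρ : ℝ => poissonKernel 0 (t / ρ) s) 1 := by
          simp only [poissonKernel_zero_eq]
          have h1 : ContinuousAt (fun ρ : ℝ => t / (ρ : ℂ)) 1 :=
            continuousAt_const.div Complex.continuous_ofReal.continuousAt (by simp)
          refine ContinuousAt.div (continuousAt_const.sub (h1.norm.pow 2))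
            ((continuousAt_const.sub h1).norm.pow 2) ?_
          simpa using coe_sub_ne_zero ht s
        have := hc.tendsto
        simp only [Complex.ofReal_one, div_one] at this
        exact this.mono_left nhdsWithin_le_nhds
      · rw [Metric.tendsto_nhds]
        intro ε hε
        filter_upwards [hs ε hε] with ρ hρ
        rw [Real.dist_eq, abs_of_nonneg (sub_nonneg.2 (le_max_right _ _)), sub_lt_iff_lt_add']
        exact max_lt hρ (by linarith)
  refine ge_of_tendsto hlim' ?_
  filter_upwards [eventually_pos_nhdsLT_one, self_mem_nhdsWithin, hlt] with ρ h0 h1 h2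
  have hmem : t / (ρ : ℂ) ∈ ball (0 : ℂ) 1 := mem_ball_zero_iff.2 (h2.trans hb1)
  have hρ0 : (ρ : ℂ) ≠ 0 := by exact_mod_cast h0.ne'
  have h3 := le_poissonInt_of_submean (huscρ ρ h0 h1) (v := v ρ) (t := t / ρ) ?_
    (Integrable.of_bound (hvm ρ h0 h1).aestronglyMeasurable M (ae_of_all _ (hvb ρ h0 h1)))
    (fun s => le_max_left _ _) hmem
  · rwa [mul_div_cancel₀ _ hρ0] at h3
  · intro a τ haτ
    have := hsub (ρ * a) (ρ * τ) fun ζ hζ => by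
      rw [mul_left_comm, ← mul_add]
      exact mem_ball_zero_iff.1 (hmaps ρ h0 h1 (mem_closedBall_zero_iff.2 (haτ ζ hζ)))
    simpa only [mul_left_comm _ (ρ : ℂ), ← mul_add] using this

/-! ### The bilinear pairing and convex conjugates -/

/-- The linear form `w ↦ a · w`. -/
def cdotCLM {n : ℕ} (a : Cn n) : Cn n →L[ℂ] ℂ :=
  LinearMap.toContinuousLinearMap
    { toFun := cdot a
      map_add' := fun x y => by simp [cdot, mul_add, Finset.sum_add_distrib]
      map_smul' := fun c x => by simp [cdot, Finset.mul_sum, mul_left_comm] }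

@[simp] lemma cdotCLM_apply {n : ℕ} (a w : Cn n) : cdotCLM a w = cdot a w := rfl

lemma cdot_comm {n : ℕ} (a w : Cn n) : cdot a w = cdot w a := by
  simp [cdot, mul_comm]

lemma exists_eq_cdot {n : ℕ} (l : Cn n →L[ℂ] ℂ) : ∃ a : Cn n, ∀ w, l w = cdot a w := by
  refine ⟨WithLp.toLp 2 fun j => l (EuclideanSpace.single j 1), fun w => ?_⟩
  have hw : w = ∑ j, w j • EuclideanSpace.single j (1 : ℂ) := by
    ext i
    simp [Finset.sum_apply, Pi.single_apply]
  conv_lhs => rw [hw]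
  simp [cdot, mul_comm]

/-- The real linear form `w ↦ Re (a · w)`. -/
def reCdot {n : ℕ} (a : Cn n) : Cn n →L[ℝ] ℝ :=
  Complex.reCLM.comp ((cdotCLM a).restrictScalars ℝ)

@[simp] lemma reCdot_apply {n : ℕ} (a w : Cn n) : reCdot a w = (cdot a w).re := rfl

lemma reCdot_comm {n : ℕ} (a w : Cn n) : reCdot a w = reCdot w a := by
  simp [cdot_comm a w]

/-- The convex conjugate `φ*_s(a) = sup_w (Re (a · w) - φ_s(w))`, over a dense sequence of `w`. -/
def convexConj {n : ℕ} (φ : DiskBoundary → Cn n → ℝ) (a : Cn n) (s : DiskBoundary) : ℝ :=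
  ⨆ k : ℕ, (reCdot a (TopologicalSpace.denseSeq (Cn n) k) -
    φ s (TopologicalSpace.denseSeq (Cn n) k))

section

variable {n : ℕ} {p : ℝ} {φ : DiskBoundary → Cn n → ℝ}

/-- Beyond the threshold `(b/c)^{1/(p-1)}` the power term dominates and the difference is
nonpositive; below it `b x` is bounded. -/
lemma exists_mul_sub_mul_rpow_le {p c : ℝ} (hp : 1 < p) (hc : 0 < c) {b : ℝ} (hb : 0 ≤ b) :
    ∃ B : ℝ, ∀ x : ℝ, 0 ≤ x → b * x - c * x ^ p ≤ B := by
  have hp1 : 0 < p - 1 := by linarith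
  refine ⟨b * (b / c) ^ (1 / (p - 1)), fun x hx => ?_⟩
  rcases le_total x ((b / c) ^ (1 / (p - 1))) with h | h
  · have h1 : 0 ≤ c * x ^ p := by positivity
    have h2 : b * x ≤ b * (b / c) ^ (1 / (p - 1)) := by gcongr
    linarith
  · have h1 : b / c ≤ x ^ (p - 1) := by
      have := Real.rpow_le_rpow (by positivity) h hp1.le
      rwa [← Real.rpow_mul (by positivity), one_div, inv_mul_cancel₀ hp1.ne', Real.rpow_one] at this
    have h2 : x ^ p = x ^ (p - 1) * x := by
      rcases hx.eq_or_lt with rfl | hx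
      · rw [Real.zero_rpow (by linarith), mul_zero]
      · rw [← Real.rpow_add_one hx.ne', sub_add_cancel]
    rw [div_le_iff₀ hc] at h1
    have h3 : b * x ≤ x ^ (p - 1) * c * x := by gcongr
    have h4 : 0 ≤ b * (b / c) ^ (1 / (p - 1)) := by positivity
    rw [h2]
    nlinarith

lemma UniformGrowth.exists_abs_le (hgrowth : UniformGrowth p φ) :
    ∃ C A : ℝ, 0 < C ∧ 0 < A ∧ ∀ s w, |φ s w| ≤ C * ‖w‖ ^ p + A := by
  obtain ⟨c, C, A, hc, hC, hA, h⟩ := hgrowth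
  refine ⟨C, A, hC, hA, fun s w => abs_le.2 ⟨?_, (h s w).2⟩⟩
  have h1 : 0 ≤ c * ‖w‖ ^ p := by positivity
  have h2 : 0 ≤ C * ‖w‖ ^ p := by positivity
  linarith [(h s w).1]

lemma UniformGrowth.exists_reCdot_sub_le (hp : 1 < p) (hgrowth : UniformGrowth p φ) (a : Cn n) :
    ∃ B : ℝ, ∀ s w, reCdot a w - φ s w ≤ B := by
  obtain ⟨c, C, A, hc, hC, hA, h⟩ := hgrowth
  obtain ⟨B, hB⟩ := exists_mul_sub_mul_rpow_le hp hc (norm_nonneg (reCdot a))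
  refine ⟨B + A, fun s w => ?_⟩
  have h1 := (Real.le_norm_self _).trans ((reCdot a).le_opNorm w)
  have h2 := hB ‖w‖ (norm_nonneg w)
  linarith [(h s w).1]

lemma bddAbove_range_convexConj (hp : 1 < p) (hgrowth : UniformGrowth p φ) (a : Cn n)
    (s : DiskBoundary) : BddAbove (range fun k : ℕ =>
      reCdot a (TopologicalSpace.denseSeq (Cn n) k) - φ s (TopologicalSpace.denseSeq (Cn n) k)) := by
  obtain ⟨B, hB⟩ := hgrowth.exists_reCdot_sub_le hp a
  exact ⟨B, by rintro _ ⟨k, rfl⟩; exact hB s _⟩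

lemma continuous_of_convexOn_univ {E : Type*} [NormedAddCommGroup E] [NormedSpace ℝ E]
    [FiniteDimensional ℝ E] {f : E → ℝ} (hf : ConvexOn ℝ univ f) : Continuous f :=
  continuousOn_univ.1 (hf.continuousOn isOpen_univ)

/-- Fenchel–Young. Continuity of the convex function `φ_s` extends the inequality from the dense
sequence, which was used to make the conjugate measurable in `s`. -/
lemma reCdot_sub_le_convexConj (hp : 1 < p) (hgrowth : UniformGrowth p φ)
    (hconv : ∀ s, ConvexOn ℝ univ (φ s)) (a w : Cn n) (s : DiskBoundary) :
    reCdot a w - φ s w ≤ convexConj φ a s := by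
  have hc : Continuous fun w => reCdot a w - φ s w :=
    (reCdot a).continuous.sub (continuous_of_convexOn_univ (hconv s))
  exact (TopologicalSpace.denseRange_denseSeq (Cn n)).induction_on w
    (isClosed_le hc continuous_const)
    fun k => le_ciSup (bddAbove_range_convexConj hp hgrowth a s) k

lemma convexConj_le {a : Cn n} {s : DiskBoundary} {B : ℝ}
    (h : ∀ w, reCdot a w - φ s w ≤ B) : convexConj φ a s ≤ B :=
  ciSup_le fun _ => h _

lemma measurable_apply (hmeas : Measurable (fun x : DiskBoundary × Cn n => φ x.1 x.2)) (w : Cn n) :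
    Measurable fun s => φ s w :=
  hmeas.comp (measurable_id.prodMk measurable_const)

lemma integrable_apply
    (hmeas : Measurable (fun x : DiskBoundary × Cn n => φ x.1 x.2))
    (hgrowth : UniformGrowth p φ) (w : Cn n) :
    Integrable (fun s => φ s w) boundaryMeasure := by
  obtain ⟨C, A, -, -, h⟩ := hgrowth.exists_abs_le
  exact Integrable.of_bound (measurable_apply hmeas w).aestronglyMeasurable _
    (ae_of_all _ fun s => h s w)

lemma integrable_convexConj (hp : 1 < p)
    (hmeas : Measurable (fun x : DiskBoundary × Cn n => φ x.1 x.2))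
    (hgrowth : UniformGrowth p φ) (hconv : ∀ s, ConvexOn ℝ univ (φ s)) (a : Cn n) :
    Integrable (convexConj φ a) boundaryMeasure := by
  have hm : Measurable (convexConj φ a) :=
    Measurable.iSup fun k => measurable_const.sub (measurable_apply hmeas _)
  obtain ⟨C, A, -, -, h⟩ := hgrowth.exists_abs_le
  obtain ⟨B, hB⟩ := hgrowth.exists_reCdot_sub_le hp a
  refine Integrable.of_bound hm.aestronglyMeasurable (max B (C * ‖(0 : Cn n)‖ ^ p + A))
    (ae_of_all _ fun s => abs_le.2 ⟨?_, (convexConj_le (hB s)).trans (le_max_left _ _)⟩)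
  have h1 := reCdot_sub_le_convexConj hp hgrowth hconv a 0 s
  rw [map_zero, zero_sub] at h1
  have h2 := (abs_le.1 (h s 0)).2
  linarith [le_max_right B (C * ‖(0 : Cn n)‖ ^ p + A)]

/-- A finite supremum of affine functions is convex, hence continuous in finite dimension. -/
lemma continuous_convexConj (hp : 1 < p) (hgrowth : UniformGrowth p φ)
    (hconv : ∀ s, ConvexOn ℝ univ (φ s)) (s : DiskBoundary) :
    Continuous fun a => convexConj φ a s := by
  refine continuous_of_convexOn_univ ⟨convex_univ, fun a _ b _ x y hx hy hxy => ?_⟩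
  refine convexConj_le fun w => ?_
  have ha := reCdot_sub_le_convexConj hp hgrowth hconv a w s
  have hb := reCdot_sub_le_convexConj hp hgrowth hconv b w s
  rw [reCdot_comm] at ha hb ⊢
  rw [map_add, map_smul, map_smul]
  simp only [smul_eq_mul]
  have h1 : φ s w = x * φ s w + y * φ s w := by rw [← add_mul, hxy, one_mul]
  nlinarith [mul_le_mul_of_nonneg_left ha hx, mul_le_mul_of_nonneg_left hb hy]

/-- Fenchel–Moreau duality, with the slope taken from a dense sequence. -/
lemma exists_lt_reCdot_sub_convexConj (hp : 1 < p) (hgrowth : UniformGrowth p φ)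
    (hconv : ∀ s, ConvexOn ℝ univ (φ s)) (s : DiskBoundary) (z : Cn n) {b : ℝ} (hb : b < φ s z) :
    ∃ k : ℕ, b < reCdot (TopologicalSpace.denseSeq (Cn n) k) z -
      convexConj φ (TopologicalSpace.denseSeq (Cn n) k) s := by
  obtain ⟨b', hbb', hb'⟩ := exists_between hb
  have hlsc : LowerSemicontinuousOn (φ s) univ :=
    (continuous_of_convexOn_univ (hconv s)).continuousOn.lowerSemicontinuousOn
  -- An affine minorant with value `b'` at `z` has constant term `c ≤ -φ*_s(a)`. The gap between `b`
  -- and `b'` leaves room to move `a` into the dense sequence.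
  obtain ⟨l, c, hle, heq⟩ := (hconv s).exists_affine_le_of_lt (𝕜 := ℂ) (mem_univ z) hb'
    isClosed_univ hlsc
  obtain ⟨a, ha⟩ := exists_eq_cdot l
  have hle' (w : Cn n) : reCdot a w + c ≤ φ s w := by
    have := hle ⟨w, mem_univ w⟩
    simpa [ha] using this
  have hza : reCdot a z + c = b' := by simpa [ha] using heq
  have hconj : convexConj φ a s ≤ -c := convexConj_le fun w => by linarith [hle' w]
  have hc : Continuous fun a => reCdot a z - convexConj φ a s := by
    simp only [reCdot_comm _ z]
    exact (reCdot z).continuous.sub (continuous_convexConj hp hgrowth hconv s)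
  obtain ⟨k, hk⟩ := (TopologicalSpace.denseRange_denseSeq (Cn n)).exists_mem_open
    (isOpen_Ioi.preimage hc) ⟨a, (by simp only [mem_preimage, mem_Ioi]; linarith :
      a ∈ (fun a => reCdot a z - convexConj φ a s) ⁻¹' Ioi b)⟩
  exact ⟨k, hk⟩

/-- A convex function bounded by `M` on the ball of radius `R + 1` is `2M`-Lipschitz on the ball of
radius `R`; the growth condition makes `M` independent of `s`. -/
lemma exists_lipschitz_on_ball (hp : 1 < p) (hgrowth : UniformGrowth p φ)
    (hconv : ∀ s, ConvexOn ℝ univ (φ s)) (R : ℝ) :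
    ∃ K : ℝ, 0 ≤ K ∧ ∀ s, ∀ w ∈ ball (0 : Cn n) R, ∀ z ∈ ball (0 : Cn n) R,
      |φ s w - φ s z| ≤ K * dist w z := by
  obtain ⟨C, A, hC, hA, h⟩ := hgrowth.exists_abs_le
  set M := C * |R + 1| ^ p + A with hM
  refine ⟨_, NNReal.coe_nonneg (2 * M / 1).toNNReal, fun s w hw z hz => ?_⟩
  have h1 := ((hconv s).subset (subset_univ _)
    (convex_ball (0 : Cn n) (R + 1))).lipschitzOnWith_of_abs_le one_pos (M := M) fun a ha => (h s a).trans (by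
      rw [dist_zero_right] at ha
      have : ‖a‖ ≤ |R + 1| := ha.le.trans (le_abs_self _)
      rw [hM]
      have hp0 : 0 ≤ p := by linarith
      gcongr)
  rw [add_sub_cancel_right] at h1
  simpa [Real.dist_eq] using h1.dist_le_mul w hw z hz

end

section

variable {n : ℕ} {p : ℝ} {φ : DiskBoundary → Cn n → ℝ}

/-! ### Boundary values of functions between the two envelopes -/

/-- Functions between the affine minorants `Re (a · w) - P[φ*(a)](t)` and the majorant
`P[φ(·, w)](t)` are finite and have the boundary values `φ`. -/
lemma exists_tendstoLocallyUniformly (hp : 1 < p)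
    (hmeas : Measurable (fun x : DiskBoundary × Cn n => φ x.1 x.2))
    (hconv : ∀ s : DiskBoundary, ConvexOn ℝ univ (φ s)) (hgrowth : UniformGrowth p φ)
    {H : ℂ → Cn n → EReal}
    (hlow : ∀ a : Cn n, ∀ t ∈ ball (0 : ℂ) 1, ∀ w : Cn n,
      ((reCdot a w - poissonInt (convexConj φ a) t : ℝ) : EReal) ≤ H t w)
    (hup : ∀ t ∈ ball (0 : ℂ) 1, ∀ w : Cn n,
      H t w ≤ ((poissonInt (fun s => φ s w) t : ℝ) : EReal)) :
    ∃ Φ : ℂ → Cn n → ℝ,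
      (∀ t ∈ ball (0 : ℂ) 1, ∀ w : Cn n, H t w = ((Φ t w : ℝ) : EReal)) ∧
      ∀ᵐ s : DiskBoundary ∂boundaryMeasure,
        TendstoLocallyUniformly (fun r : ℝ => Φ ((r : ℂ) * (s : ℂ))) (φ s) (𝓝[<] (1 : ℝ)) := by
  have hfin : ∀ t ∈ ball (0 : ℂ) 1, ∀ w : Cn n, H t w = (((H t w).toReal : ℝ) : EReal) := by
    intro t ht w
    refine (EReal.coe_toReal ?_ ?_).symm
    · exact ne_top_of_le_ne_top (EReal.coe_ne_top _) (hup t ht w)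
    · exact ne_bot_of_le_ne_bot (EReal.coe_ne_bot _) (hlow 0 t ht w)
  refine ⟨fun t w => (H t w).toReal, hfin, ?_⟩
  have hlow' (a : Cn n) (t : ℂ) (ht : t ∈ ball (0 : ℂ) 1) (w : Cn n) :
      reCdot a w - poissonInt (convexConj φ a) t ≤ (H t w).toReal := by
    rw [← EReal.coe_le_coe_iff, ← hfin t ht w]; exact hlow a t ht w
  have hup' (t : ℂ) (ht : t ∈ ball (0 : ℂ) 1) (w : Cn n) :
      (H t w).toReal ≤ poissonInt (fun s => φ s w) t := by
    rw [← EReal.coe_le_coe_iff, ← hfin t ht w]; exact hup t ht w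
  set d := TopologicalSpace.denseSeq (Cn n) with hd
  have hU := ae_all_iff.2 fun k : ℕ => ae_tendsto_poissonInt (integrable_apply hmeas hgrowth (d k))
  have hL := ae_all_iff.2 fun k : ℕ =>
    ae_tendsto_poissonInt (integrable_convexConj hp hmeas hgrowth hconv (d k))
  filter_upwards [hU, hL] with s hUs hLs
  have hφc := continuous_of_convexOn_univ (hconv s)
  rw [Metric.tendstoLocallyUniformly_iff]
  intro ε hε z
  obtain ⟨K, hK0, hK⟩ := exists_lipschitz_on_ball hp hgrowth hconv (‖z‖ + 1)
  set δ : ℝ := min 1 (ε / (8 * (K + 1))) with hδ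
  have hδ0 : 0 < δ := by positivity
  have hKδ : K * (2 * δ) ≤ ε / 4 := by
    have h1 : δ ≤ ε / (8 * (K + 1)) := min_le_right _ _
    rw [le_div_iff₀ (by positivity)] at h1
    nlinarith
  have hsub : ball z δ ⊆ ball (0 : Cn n) (‖z‖ + 1) := by
    intro w hw
    rw [mem_ball_iff_norm] at hw
    rw [mem_ball_zero_iff]
    have h1 := norm_le_norm_add_norm_sub' w z
    have h2 : δ ≤ 1 := min_le_left _ _
    linarith
  obtain ⟨k, hk⟩ := (TopologicalSpace.denseRange_denseSeq (Cn n)).exists_mem_open isOpen_ball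
    ⟨z, mem_ball_self hδ0⟩
  -- Uniformity over all `s'` is essential: the comparison is integrated against the Poisson kernel
  -- to replace `w` by `d k`.
  have hclose (w : Cn n) (hw : w ∈ ball z δ) (s' : DiskBoundary) :
      |φ s' w - φ s' (d k)| ≤ ε / 4 := by
    refine (hK s' w (hsub hw) (d k) (hsub hk)).trans (le_trans ?_ hKδ)
    gcongr
    have := dist_triangle_right w (d k) z
    rw [mem_ball] at hw hk
    linarith
  obtain ⟨m, hm⟩ := exists_lt_reCdot_sub_convexConj hp hgrowth hconv s z
    (show φ s z - ε / 4 < φ s z by linarith)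
  have hnear : ∀ᶠ w in 𝓝 z, φ s w - reCdot (d m) w < φ s z - reCdot (d m) z + ε / 4 :=
    ((hφc.sub (reCdot (d m)).continuous).tendsto z).eventually_lt_const (by simp [hε])
  refine ⟨_, inter_mem (ball_mem_nhds z hδ0) hnear, ?_⟩
  filter_upwards [eventually_pos_nhdsLT_one, self_mem_nhdsWithin,
    (hUs k).eventually_lt_const (show φ s (d k) < φ s (d k) + ε / 4 by linarith),
    (hLs m).eventually_lt_const
      (show convexConj φ (d m) s < convexConj φ (d m) s + ε / 4 by linarith)]
    with r hr0 hr1 h1 h2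
  rintro w ⟨hw1, hw2⟩
  have ht := real_mul_mem_ball hr0 hr1 s
  rw [Real.dist_eq, abs_lt]
  constructor
  -- Upper estimate: two moves between `w` and `d k` and one Fatou limit cost `ε/4` each. The lower
  -- estimate likewise spends `ε/4` on duality at `z`, on Fatou for `φ*(d m)`, and on passing from
  -- `z` to `w`.
  · have h3 := hup' _ ht w
    have h4 : poissonInt (fun s => φ s w) (r * s) ≤
        poissonInt (fun s => φ s (d k) + ε / 4) (r * s) :=
      poissonInt_mono ht (integrable_apply hmeas hgrowth w)
        ((integrable_apply hmeas hgrowth (d k)).add (integrable_const _))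
        (ae_of_all _ fun s' => by linarith [(abs_le.1 (hclose w hw1 s')).2])
    rw [poissonInt_add ht (integrable_apply hmeas hgrowth (d k)) (integrable_const _),
      poissonInt_const ht] at h4
    linarith [(abs_le.1 (hclose w hw1 s)).1]
  · have h3 := hlow' (d m) _ ht w
    simp only [mem_ofPred_eq] at hw2
    linarith

/-! ### Comparison of the hulls with the two envelopes -/

/-- The joint upper limit is restricted to radii with the second variable frozen, which suffices for
the upper bounds. -/
lemma BoundaryLE.ae_eventually_lt {ψ : ℂ → Cn n → ℝ} (h : BoundaryLE ψ φ) :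
    ∀ᵐ s : DiskBoundary ∂boundaryMeasure, ∀ w : Cn n, ∀ ε > 0,
      ∀ᶠ r : ℝ in 𝓝[<] 1, ψ (r * s) w < φ s w + ε := by
  filter_upwards [h] with s hs w ε hε
  have h1 : ((φ s w : ℝ) : EReal) < ((φ s w + ε : ℝ) : EReal) :=
    EReal.coe_lt_coe_iff.2 (by linarith)
  have h2 := eventually_lt_of_limsup_lt ((hs w).trans_lt h1)
  have h3 : Tendsto (fun r : ℝ => (r, w)) (𝓝[<] 1) (𝓝[<] (1 : ℝ) ×ˢ 𝓝 w) :=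
    tendsto_id.prodMk tendsto_const_nhds
  filter_upwards [h3.eventually h2] with r hr
  exact EReal.coe_lt_coe_iff.1 hr

lemma linFun_eq_poissonInt {f₀ : DiskBoundary → ℂ} {f : DiskBoundary → Cn n}
    (hf₀ : Integrable f₀ boundaryMeasure) (hf : Integrable f boundaryMeasure) {t : ℂ}
    (ht : t ∈ ball (0 : ℂ) 1) (w : Cn n) :
    linFun f₀ f t w = poissonInt (fun s => reCdot w (f s) - (f₀ s).re) t := by
  have h1 : Integrable (fun s => reCdot w (f s)) boundaryMeasure := (reCdot w).integrable_comp hf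
  have h2 : Integrable (fun s => (f₀ s).re) boundaryMeasure := hf₀.re
  rw [poissonInt_sub ht h1 h2, poissonInt_clm _ ht hf, ← reCdot_comm]
  rfl

/-- For fixed `w` the function is itself the Poisson integral of an integrable function. Fatou
identifies its radial limits with that integrand, so the boundary condition becomes an almost
everywhere inequality to be integrated. -/
lemma linFun_le_poissonInt
    (hmeas : Measurable (fun x : DiskBoundary × Cn n => φ x.1 x.2)) (hgrowth : UniformGrowth p φ)
    {f₀ : DiskBoundary → ℂ} {f : DiskBoundary → Cn n}
    (hf₀ : Integrable f₀ boundaryMeasure) (hf : Integrable f boundaryMeasure)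
    (hle : BoundaryLE (linFun f₀ f) φ) {t : ℂ} (ht : t ∈ ball (0 : ℂ) 1) (w : Cn n) :
    linFun f₀ f t w ≤ poissonInt (fun s => φ s w) t := by
  have hi : Integrable (fun s => reCdot w (f s) - (f₀ s).re) boundaryMeasure :=
    ((reCdot w).integrable_comp hf).sub hf₀.re
  rw [linFun_eq_poissonInt hf₀ hf ht]
  refine poissonInt_mono ht hi (integrable_apply hmeas hgrowth w) ?_
  filter_upwards [hle.ae_eventually_lt, ae_tendsto_poissonInt hi] with s h1 h2
  refine le_of_forall_pos_le_add fun ε hε => le_of_tendsto h2 ?_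
  filter_upwards [h1 w ε hε, eventually_pos_nhdsLT_one, self_mem_nhdsWithin] with r h3 hr0 hr1
  rw [linFun_eq_poissonInt hf₀ hf (real_mul_mem_ball hr0 hr1 s)] at h3
  exact h3.le

lemma linFun_const_eq {g : DiskBoundary → ℝ} (a : Cn n) {t : ℂ} (ht : t ∈ ball (0 : ℂ) 1)
    (w : Cn n) :
    linFun (fun s => (g s : ℂ)) (fun _ => a) t w = reCdot a w - poissonInt g t := by
  simp [linFun, poissonInt_const ht]

lemma boundaryLE_linFun_convexConj (hp : 1 < p)
    (hmeas : Measurable (fun x : DiskBoundary × Cn n => φ x.1 x.2))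
    (hconv : ∀ s : DiskBoundary, ConvexOn ℝ univ (φ s)) (hgrowth : UniformGrowth p φ) (a : Cn n) :
    BoundaryLE (linFun (fun s => (convexConj φ a s : ℂ)) (fun _ => a)) φ := by
  filter_upwards [ae_tendsto_poissonInt (integrable_convexConj hp hmeas hgrowth hconv a)]
    with s hs z
  have h1 : Tendsto (fun x : ℝ × Cn n => reCdot a x.2 - poissonInt (convexConj φ a) (x.1 * s))
      (𝓝[<] (1 : ℝ) ×ˢ 𝓝 z) (𝓝 (reCdot a z - convexConj φ a s)) :=
    (((reCdot a).continuous.tendsto z).comp tendsto_snd).sub (hs.comp tendsto_fst)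
  have h2 : Tendsto (fun x : ℝ × Cn n =>
      ((linFun (fun s => (convexConj φ a s : ℂ)) (fun _ => a) (x.1 * s) x.2 : ℝ) : EReal))
      (𝓝[<] (1 : ℝ) ×ˢ 𝓝 z) (𝓝 ((reCdot a z - convexConj φ a s : ℝ) : EReal)) := by
    refine ((continuous_coe_real_ereal.tendsto _).comp h1).congr' ?_
    filter_upwards [tendsto_fst.eventually eventually_pos_nhdsLT_one,
      tendsto_fst.eventually (self_mem_nhdsWithin : Iio (1 : ℝ) ∈ 𝓝[<] 1)] with x hx0 hx1
    rw [linFun_const_eq a (real_mul_mem_ball hx0 hx1 s)]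
    rfl
  rw [h2.limsup_eq, EReal.coe_le_coe_iff]
  linarith [reCdot_sub_le_convexConj hp hgrowth hconv a z s]

lemma isHardyBoundary_const (r : ℝ) (a : Cn n) : IsHardyBoundary r (fun _ => a) :=
  ⟨memLp_const a, (differentiableOn_const a).congr fun _ ht => poissonInt_const ht a⟩

/-- The function is the real part of a holomorphic function of `(t, w)`, so the mean value property
holds with equality. -/
lemma isPSH_linFun_const {g : DiskBoundary → ℝ} (hg : Integrable g boundaryMeasure) (a : Cn n) :
    IsPSH (linFun (fun s => (g s : ℂ)) (fun _ => a)) := by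
  obtain ⟨F, hF, hFg⟩ := exists_differentiableOn_re_eq_poissonInt hg
  have heq (t : ℂ) (ht : t ∈ ball (0 : ℂ) 1) (w : Cn n) :
      linFun (fun s => (g s : ℂ)) (fun _ => a) t w = (cdotCLM a w - F t).re := by
    rw [linFun_const_eq a ht, hFg t ht]
    simp
  refine ⟨?_, fun t τ w v hdisc => ?_⟩
  · refine ContinuousOn.upperSemicontinuousOn ?_
    have hc : ContinuousOn (fun x : ℂ × Cn n => (cdotCLM a x.2 - F x.1).re)
        (ball (0 : ℂ) 1 ×ˢ univ) := by
      refine Complex.continuous_re.comp_continuousOn (ContinuousOn.sub ?_ ?_)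
      · exact ((cdotCLM a).continuous.comp continuous_snd).continuousOn
      · exact hF.continuousOn.comp continuous_fst.continuousOn fun x hx => hx.1
    exact hc.congr fun x hx => heq x.1 hx.1 x.2
  · set G : ℂ → ℂ := fun ζ => cdotCLM a (w + ζ • v) - F (t + ζ * τ) with hG
    have hmaps : MapsTo (fun ζ : ℂ => t + ζ * τ) (closedBall 0 1) (ball 0 1) := fun ζ hζ =>
      mem_ball_zero_iff.2 (hdisc ζ (mem_closedBall_zero_iff.1 hζ))
    have hGd : DifferentiableOn ℂ G (closedBall 0 1) := by
      refine DifferentiableOn.sub ?_ ?_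
      · exact ((cdotCLM a).differentiable.comp (by fun_prop)).differentiableOn
      · exact hF.comp (by fun_prop) hmaps
    have hGi : CircleIntegrable G 0 1 :=
      (hGd.continuousOn.mono (by simp [sphere_subset_closedBall])).circleIntegrable'
    have hdc : DiffContOnCl ℂ G (ball 0 |1|) := by
      rw [abs_one]
      refine DifferentiableOn.diffContOnCl ?_
      rwa [closure_ball (0 : ℂ) one_ne_zero]
    have hav := Complex.reCLM.circleAverage_comp_comm hGi
    rw [hdc.circleAverage] at hav
    have hsph (ζ : ℂ) (hζ : ζ ∈ sphere (0 : ℂ) |1|) :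
        (Complex.reCLM ∘ G) ζ =
          linFun (fun s => (g s : ℂ)) (fun _ => a) (t + ζ * τ) (w + ζ • v) := by
      rw [abs_one] at hζ
      rw [heq _ (hmaps (sphere_subset_closedBall hζ))]
      rfl
    constructor
    · have hc : ContinuousOn (Complex.reCLM ∘ G) (sphere 0 |1|) :=
        Complex.reCLM.continuous.comp_continuousOn
          (hGd.continuousOn.mono (by simp [sphere_subset_closedBall]))
      exact (hc.congr fun ζ hζ => (hsph ζ hζ).symm).circleIntegrable'
    · rw [← Real.circleAverage_congr_sphere hsph, hav,
        heq t (by simpa using hmaps (mem_closedBall_self zero_le_one))]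
      simp [hG]

/-- The slice at fixed `w` is subharmonic in `t`. The bound by `sup_s φ(s, w)` makes it bounded
above, without which radial boundary values would not control it. -/
lemma IsPSH.le_poissonInt
    (hmeas : Measurable (fun x : DiskBoundary × Cn n => φ x.1 x.2)) (hgrowth : UniformGrowth p φ)
    {ψ : ℂ → Cn n → ℝ} (hψ : IsPSH ψ)
    (hsup : ∀ t' ∈ ball (0 : ℂ) 1, ∀ w' : Cn n,
      ((ψ t' w' : ℝ) : EReal) ≤ ⨆ s : DiskBoundary, ((φ s w' : ℝ) : EReal))
    (hle : BoundaryLE ψ φ) {t : ℂ} (ht : t ∈ ball (0 : ℂ) 1) (w : Cn n) :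
    ψ t w ≤ poissonInt (fun s => φ s w) t := by
  obtain ⟨C, A, -, -, h⟩ := hgrowth.exists_abs_le
  refine le_poissonInt_of_radial (u := fun t => ψ t w) ?_ ?_ (measurable_apply hmeas w)
    (M := C * ‖w‖ ^ p + A) (fun s => h s w) ?_ ?_ ht
  · intro x hx y hy
    have hc : Tendsto (fun t : ℂ => (t, w)) (𝓝[ball 0 1] x) (𝓝[ball 0 1 ×ˢ univ] (x, w)) := by
      refine ContinuousWithinAt.tendsto_nhdsWithin (by fun_prop) fun t ht => ⟨ht, mem_univ _⟩
    exact hc.eventually (hψ.1 (x, w) ⟨hx, mem_univ _⟩ y hy)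
  · intro a τ haτ
    simpa using hψ.2 a τ w 0 haτ
  · intro t ht
    rw [← EReal.coe_le_coe_iff]
    exact (hsup t ht w).trans
      (iSup_le fun s => EReal.coe_le_coe_iff.2 (abs_le.1 (h s w)).2)
  · filter_upwards [hle.ae_eventually_lt] with s hs ε hε
    exact hs w ε hε

/-- Fenchel–Young gives `φ*_s(a) ≥ Re (a · w) - sup_s φ(s, w)` for every `s`; averaging against the
Poisson kernel, of mass one, preserves it. -/
lemma linFun_convexConj_le_iSup (hp : 1 < p)
    (hmeas : Measurable (fun x : DiskBoundary × Cn n => φ x.1 x.2))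
    (hconv : ∀ s : DiskBoundary, ConvexOn ℝ univ (φ s)) (hgrowth : UniformGrowth p φ) (a : Cn n)
    {t : ℂ} (ht : t ∈ ball (0 : ℂ) 1) (w : Cn n) :
    ((linFun (fun s => (convexConj φ a s : ℂ)) (fun _ => a) t w : ℝ) : EReal) ≤
      ⨆ s : DiskBoundary, ((φ s w : ℝ) : EReal) := by
  obtain ⟨C, A, -, -, h⟩ := hgrowth.exists_abs_le
  set S : EReal := ⨆ s : DiskBoundary, ((φ s w : ℝ) : EReal) with hS
  have hle (s : DiskBoundary) : ((φ s w : ℝ) : EReal) ≤ S :=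
    le_iSup (fun s : DiskBoundary => ((φ s w : ℝ) : EReal)) s
  have htop : S ≠ ⊤ := ne_top_of_le_ne_top (EReal.coe_ne_top (C * ‖w‖ ^ p + A))
    (iSup_le fun s => EReal.coe_le_coe_iff.2 (abs_le.1 (h s w)).2)
  have hbot : S ≠ ⊥ := ne_bot_of_le_ne_bot (EReal.coe_ne_bot _) (hle (expPoint 0))
  clear_value S
  lift S to ℝ using ⟨htop, hbot⟩
  rw [EReal.coe_le_coe_iff, linFun_const_eq a ht, sub_le_comm]
  have h1 : poissonInt (fun _ => reCdot a w - S) t ≤ poissonInt (convexConj φ a) t :=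
    poissonInt_mono ht (integrable_const _) (integrable_convexConj hp hmeas hgrowth hconv a)
      (ae_of_all _ fun s => by
        have h2 := reCdot_sub_le_convexConj hp hgrowth hconv a w s
        have h3 := EReal.coe_le_coe_iff.1 (hle s)
        linarith)
  rwa [poissonInt_const ht] at h1

lemma le_poissonInt_comp (hp : 1 < p)
    (hmeas : Measurable (fun x : DiskBoundary × Cn n => φ x.1 x.2))
    (hconv : ∀ s : DiskBoundary, ConvexOn ℝ univ (φ s)) (hgrowth : UniformGrowth p φ) (a : Cn n)
    {f : DiskBoundary → Cn n} (hf : MemLp f (ENNReal.ofReal p) boundaryMeasure)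
    {t : ℂ} (ht : t ∈ ball (0 : ℂ) 1) :
    reCdot a (poissonInt f t) - poissonInt (convexConj φ a) t ≤
      poissonInt (fun s => φ s (f s)) t := by
  obtain ⟨C, A, -, -, h⟩ := hgrowth.exists_abs_le
  have hp0 : 0 < p := by linarith
  have hfi : Integrable f boundaryMeasure :=
    hf.integrable (by rw [← ENNReal.ofReal_one]; exact ENNReal.ofReal_le_ofReal hp.le)
  have hfp : Integrable (fun s => ‖f s‖ ^ p) boundaryMeasure := by
    have := hf.integrable_norm_rpow (by simpa using hp0) ENNReal.ofReal_ne_top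
    rwa [ENNReal.toReal_ofReal hp0.le] at this
  -- Needed because a non-integrable function would have integral `0` by convention; the `p`-growth
  -- of `φ` and `f ∈ L^p` rule this out.
  have hφf : Integrable (fun s => φ s (f s)) boundaryMeasure := by
    refine ((hfp.const_mul C).add (integrable_const A)).mono' ?_ (ae_of_all _ fun s => h s (f s))
    exact (hmeas.comp_aemeasurable
      (aemeasurable_id.prodMk hf.aestronglyMeasurable.aemeasurable)).aestronglyMeasurable
  have hconj := integrable_convexConj hp hmeas hgrowth hconv a
  have hre : Integrable (fun s => reCdot a (f s)) boundaryMeasure := (reCdot a).integrable_comp hfi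
  rw [← poissonInt_clm _ ht hfi, ← poissonInt_sub ht hre hconj]
  refine poissonInt_mono ht (hre.sub hconj) hφf (ae_of_all _ fun s => ?_)
  linarith [reCdot_sub_le_convexConj hp hgrowth hconv a (f s) s]

end

end

theorem mainTheorem5 {n : ℕ} (p : ℝ) (hp : 1 < p) (φ : DiskBoundary → Cn n → ℝ)
    (hmeas : Measurable (fun x : DiskBoundary × Cn n => φ x.1 x.2))
    (hconv : ∀ s : DiskBoundary, ConvexOn ℝ univ (φ s))
    (hgrowth : UniformGrowth p φ) :
    ∀ H ∈ ({linearHull p φ, pshHull φ, discHull p φ} : Set (ℂ → Cn n → EReal)),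
      ∃ Φ : ℂ → Cn n → ℝ,
        (∀ t ∈ ball (0 : ℂ) 1, ∀ w : Cn n, H t w = ((Φ t w : ℝ) : EReal)) ∧
        ∀ᵐ s : DiskBoundary ∂boundaryMeasure,
          TendstoLocallyUniformly (fun r : ℝ => Φ ((r : ℂ) * (s : ℂ))) (φ s) (𝓝[<] (1 : ℝ)) := by
  rintro H (rfl | rfl | rfl) <;>
    refine exists_tendstoLocallyUniformly hp hmeas hconv hgrowth (fun a t ht w => ?_)
      fun t ht w => ?_
  · exact le_sSup ⟨_, _, (integrable_convexConj hp hmeas hgrowth hconv a).ofReal,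
      isHardyBoundary_const _ a, boundaryLE_linFun_convexConj hp hmeas hconv hgrowth a,
      congrArg _ (linFun_const_eq a ht w).symm⟩
  · refine sSup_le ?_
    rintro _ ⟨f₀, f, hf₀, hf, hle, rfl⟩
    have hq : 1 ≤ p / (p - 1) := by
      rw [le_div_iff₀ (by linarith)]; linarith
    have hfi : Integrable f boundaryMeasure :=
      hf.1.integrable (by rw [← ENNReal.ofReal_one]; exact ENNReal.ofReal_le_ofReal hq)
    exact EReal.coe_le_coe_iff.2 (linFun_le_poissonInt hmeas hgrowth hf₀ hfi hle ht w)
  · exact le_sSup ⟨_, isPSH_linFun_const (integrable_convexConj hp hmeas hgrowth hconv a) a,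
      fun t' ht' w' => linFun_convexConj_le_iSup hp hmeas hconv hgrowth a ht' w',
      boundaryLE_linFun_convexConj hp hmeas hconv hgrowth a, congrArg _ (linFun_const_eq a ht w).symm⟩
  · refine sSup_le ?_
    rintro _ ⟨ψ, hψ, hsup, hle, rfl⟩
    exact EReal.coe_le_coe_iff.2 (hψ.le_poissonInt hmeas hgrowth hsup hle ht w)
  · refine le_sInf ?_
    rintro _ ⟨f, hf, rfl, rfl⟩
    exact EReal.coe_le_coe_iff.2 (le_poissonInt_comp hp hmeas hconv hgrowth a hf.1 ht)
  -- The constant disc through `w` gives the upper envelope for `φ̌`.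
  · exact sInf_le ⟨_, isHardyBoundary_const p w, poissonInt_const ht w, rfl⟩
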